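/- Let $m\ge 0$ be an integer, $2\le\alpha<4$, and let $(X_{ij})_{i,j\ge1}$ be a stationary field of real random variables with $\mathbb E X_{11}=0$ and $$\mathbb P(|X_{11}|>x)=x^{-\alpha}\widetilde L(x),\qquad x>0,$$ where $\widetilde L$ is slowly varying at infinity. Put $\hat X_{ij}=\hat X_{ji}=X_{ij}$ for $i\le j$ and assume that $\{\hat X_{ij}: i\le j\}$ is $m$-dependent, i.e. $(\hat X_{ij})_{(i,j)\in A}$ and $(\hat X_{kl})_{(k,l)\in B}$ are independent for all index sets $A,B\subseteq\{(i,j): i\le j\}$ such that $\max\{|i-k|,|j-l|\}>m$ for all $(i,j)\in A$, $(k,l)\in B$. Let $$\frac{4}{3\alpha}<\beta<\frac{2(8-\alpha)}{\alpha(10-\alpha)},\qquad \varepsilon<\min\Big\{\frac2\alpha-\frac12,\ \frac2\alpha-\beta,\ \frac14\Big(\frac8\alpha-1-\beta\big(5-\tfrac\alpha2\big)\Big)\Big\},$$ and let $\hat{\boldsymbol X}^{<}$ be the $n\times n$ matrix with entries $\hat X_{ij}\mathbf 1\{|\hat X_{ij}|<n^\beta\}$, $1\le i,j\le n$. Let $C>0$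 and let $(s_n)$ be a sequence of positive integers that is slowly varying ($s_{\lfloor cn\rfloor}/s_n\to1$ for every $c>0$) and satisfies $s_n>C\log n$ for all large $n$. Then there are constants $\gamma(C),\eta(C)>0$, depending only on $C$, such that for every $\gamma>\gamma(C)$ and all sufficiently large $n$ $$\frac{\mathbb E\,\mathrm{Tr}\Big(\big(n^{-(2/\alpha-\varepsilon)}\hat{\boldsymbol X}^{<}\big)^{2s_n}\Big)}{\big((m+1)(8+\gamma)\sqrt{2e}\big)^{2s_n}}\le\exp(-\eta(C)s_n).$$ Moreover, let $(a_n)$ be any real sequence with $n\,\mathbb P(|X_{11}|>a_n)\to1$, put $b_n=a_{n^2}$, let $\hat{\boldsymbol A}_n=(\hat X_{ij}/b_n)_{1\le i,j\le n}$, and let $\hat{\boldsymbol A}_n^{<\varepsilon_n}$ be obtained from $\hat{\boldsymbol A}_n$ by replacing with $0$ all entries of absolute value larger than $\varepsilon_n:=n^\beta/b_n$. Then the spectral norm $\|\hat{\boldsymbol A}_n^{<\varepsilon_n}\|$ tends to $0$ in probability as $n\to\infty$. -/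

import Mathlib

open MeasureTheory ProbabilityTheory Filter Topology

/-- A function `L` on the reals is slowly varying at infinity. -/
def IsSlowlyVarying (L : ℝ → ℝ) : Prop :=
  (∀ᶠ x in atTop, 0 < L x) ∧
    ∀ c : ℝ, 0 < c → Tendsto (fun x : ℝ => L (c * x) / L x) atTop (𝓝 1)

/-- A sequence of (nonnegative) integers is slowly varying: `s_⌊c n⌋ / s_n → 1` for all `c > 0`. -/
def IsSlowlyVaryingSeq (s : ℕ → ℕ) : Prop :=
  ∀ c : ℝ, 0 < c →
    Tendsto (fun n : ℕ => (s ⌊c * (n : ℝ)⌋₊ : ℝ) / (s n : ℝ)) atTop (𝓝 1)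

section Fields

variable {Ω : Type*} [MeasurableSpace Ω]

/-- A real random field indexed by the quadrant `ℕ × ℕ` (rows and columns are numbered from `0`)
is stationary: its law, as a random element of the product space, is shift invariant. -/
def IsStationaryField (X : ℕ → ℕ → Ω → ℝ) (μ : Measure Ω) : Prop :=
  ∀ k l : ℕ, IdentDistrib (fun ω (p : ℕ × ℕ) => X (p.1 + k) (p.2 + l) ω)
    (fun ω (p : ℕ × ℕ) => X p.1 p.2 ω) μ μ

/-- The family `(X i j)`, `(i, j) ∈ S`, is `m`-dependent: subfamilies whose index sets are at
sup-distance greater than `m` from each other are independent. -/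
def IsMDependentOn (m : ℕ) (S : Set (ℕ × ℕ)) (X : ℕ → ℕ → Ω → ℝ) (μ : Measure Ω) : Prop :=
  ∀ A B : Set (ℕ × ℕ), A ⊆ S → B ⊆ S →
    (∀ p ∈ A, ∀ q ∈ B,
      (m : ℤ) < max |(p.1 : ℤ) - (q.1 : ℤ)| |(p.2 : ℤ) - (q.2 : ℤ)|) →
    IndepFun (fun ω (p : A) => X p.1.1 p.1.2 ω) (fun ω (q : B) => X q.1.1 q.1.2 ω) μ

/-- The real random variable `Y` is heavy tailed with index `α`:
`P(|Y| > x) = x^{-α} L(x)` for `x > 0` with `L` slowly varying. -/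
def HasRegVaryingTail (Y : Ω → ℝ) (α : ℝ) (μ : Measure Ω) : Prop :=
  ∃ L : ℝ → ℝ, IsSlowlyVarying L ∧
    ∀ x : ℝ, 0 < x → μ.real {ω | x < |Y ω|} = x ^ (-α) * L x

/-- The symmetrized field: reflection of the upper triangular array over the diagonal. -/
def symmField (X : ℕ → ℕ → Ω → ℝ) (i j : ℕ) (ω : Ω) : ℝ := X (min i j) (max i j) ω

/-- The `n × n` matrix whose entries are the entries of the symmetrized field that are smaller
than `n ^ β` in absolute value (the other entries are replaced by `0`). -/
noncomputable def smallMatrix (X : ℕ → ℕ → Ω → ℝ) (β : ℝ) (n : ℕ) (ω : Ω) :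
    Matrix (Fin n) (Fin n) ℝ :=
  Matrix.of fun i j =>
    if |symmField X i j ω| < (n : ℝ) ^ β then symmField X i j ω else 0

/-- The normalized (Wigner) matrix with entries `X̂ i j / a_{n²}`. -/
noncomputable def wignerMatrix (X : ℕ → ℕ → Ω → ℝ) (a : ℕ → ℝ) (n : ℕ) (ω : Ω) :
    Matrix (Fin n) (Fin n) ℝ :=
  Matrix.of fun i j => symmField X i j ω / a (n ^ 2)

end Fields

/-- The truncation `A^{>ε}` keeping the entries with absolute value larger than `ε`. -/
noncomputable def truncAbove {n : ℕ} (A : Matrix (Fin n) (Fin n) ℝ) (ε : ℝ) :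
    Matrix (Fin n) (Fin n) ℝ :=
  Matrix.of fun i j => if ε < |A i j| then A i j else 0

/-- The remainder `A^{<ε} = A - A^{>ε}`. -/
noncomputable def truncBelow {n : ℕ} (A : Matrix (Fin n) (Fin n) ℝ) (ε : ℝ) :
    Matrix (Fin n) (Fin n) ℝ :=
  A - truncAbove A ε

/-- The spectral norm: the operator norm of the matrix acting on Euclidean space. -/
noncomputable def spectralNorm2 {n : ℕ} (A : Matrix (Fin n) (Fin n) ℝ) : ℝ :=
  ‖Matrix.toEuclideanCLM (n := Fin n) (𝕜 := ℝ) A‖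

/-! The normalisation leaves a positive power of n to spare, so a moment bound with crude constants
is enough and no paths need to be counted. The core is `exists_integral_norm_truncated_pow_le`: for
every σ > 1/2 with σ ≥ β and σ > 1 + β(1 - α), the 2s-th moment of the spectral norm of the
truncated matrix is at most D n² (D s n^σ)^(2s), with D independent of n, s and the convention at
the truncation level.

To prove it, the upper triangular positions are sorted by the residues of both indices modulo m + 1.
Two distinct positions with equal residues are more than m apart, so each of the (m + 1)² classes
consists of i.i.d. entries (`iIndepFun_colorClass`), and the triangle inequality reduces the problem
to a single class. There the mean is split off by symmetrization
(`integral_norm_pow_le_symmetrized`). The remaining symmetric sum is multiplied by random signs and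
handled by a noncommutative Khintchine inequality (`sum_signs_trace_pow_le`), whose variance
parameter is the largest row sum of squares; exponential moments control that
(`integral_sum_sq_pow_le`). The three conditions on σ come from the truncated variance, from the
largest entry n^β, and from the mean created by truncating a centred variable.

For the trace bound, σ is taken strictly between max(1/2, β) and 2/α - ε. The quotient D s_n n^σ /
n^(2/α - ε) is then at most a negative power of n, because s_n grows slower than any power; raised
to 2 s_n > 2 C log n it beats every polynomial (`eventually_pow_le_exp`). For the norm, b_n
eventually exceeds n^τ for each positive τ < 2/α by a Potter bound, and Markov's inequality with one
fixed large s suffices. -/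

/-! ### Symmetric matrices: trace inequalities and the noncommutative Khintchine inequality. -/

section LinearAlgebra

open Matrix
open scoped Matrix.Norms.L2Operator

variable {κ : Type*} [Fintype κ] [DecidableEq κ]

theorem Matrix.IsSymm.exists_pow_eq_diagonal {A : Matrix κ κ ℝ} (hA : A.IsSymm) :
    ∃ (U : Matrix κ κ ℝ) (l : κ → ℝ), U.transpose * U = 1 ∧ ‖A‖ = ‖l‖ ∧
      ∀ k : ℕ, A ^ k = U * diagonal (fun i => l i ^ k) * U.transpose := by
  have hH : A.IsHermitian := by
    rw [Matrix.IsHermitian, Matrix.conjTranspose_eq_transpose_of_trivial]; exact hA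
  set W := hH.eigenvectorUnitary with hW
  have hs : A = (W : Matrix κ κ ℝ) * diagonal hH.eigenvalues * star (W : Matrix κ κ ℝ) := by
    have := hH.spectral_theorem
    rw [Unitary.conjStarAlgAut_apply] at this
    simpa using this
  have hst : star (W : Matrix κ κ ℝ) = (W : Matrix κ κ ℝ).transpose := by
    rw [Matrix.star_eq_conjTranspose, Matrix.conjTranspose_eq_transpose_of_trivial]
  have h1 : (W : Matrix κ κ ℝ).transpose * (W : Matrix κ κ ℝ) = 1 := by
    rw [← hst]; exact Unitary.coe_star_mul_self W
  have h2 : (W : Matrix κ κ ℝ) * (W : Matrix κ κ ℝ).transpose = 1 := by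
    rw [← hst]; exact Unitary.coe_mul_star_self W
  refine ⟨W, hH.eigenvalues, h1, ?_, ?_⟩
  · rw [← Matrix.l2_opNorm_diagonal (𝕜 := ℝ) hH.eigenvalues]
    conv_lhs => rw [hs]
    rw [← Unitary.coe_star, CStarRing.norm_mul_coe_unitary, CStarRing.norm_coe_unitary_mul]
  · intro k
    rw [hst] at hs
    induction k with
    | zero => simp [h2]
    | succ k ih =>
      rw [pow_succ, ih]
      nth_rewrite 2 [hs]
      calc _ = (W : Matrix κ κ ℝ) * diagonal (fun i => hH.eigenvalues i ^ k) *
            ((W : Matrix κ κ ℝ).transpose * (W : Matrix κ κ ℝ)) * diagonal hH.eigenvalues *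
              (W : Matrix κ κ ℝ).transpose := by simp only [Matrix.mul_assoc]
        _ = _ := by
          rw [h1, Matrix.mul_one, Matrix.mul_assoc (W : Matrix κ κ ℝ), diagonal_mul_diagonal]
          simp only [pow_succ]

theorem Matrix.IsSymm.exists_trace_pow_eq {A : Matrix κ κ ℝ} (hA : A.IsSymm) :
    ∃ l : κ → ℝ, ‖A‖ = ‖l‖ ∧ ∀ k : ℕ, (A ^ k).trace = ∑ i, l i ^ k := by
  obtain ⟨U, l, h1, h2, h3⟩ := hA.exists_pow_eq_diagonal
  refine ⟨l, h2, fun k => ?_⟩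
  rw [h3, Matrix.trace_mul_comm, ← Matrix.mul_assoc, h1, Matrix.one_mul, Matrix.trace_diagonal]

/-- The trace of an even power is a sum of nonnegative terms, one of which belongs to the eigenvalue
of largest modulus. This and its converse up to the dimension let norms and traces be exchanged. -/
theorem Matrix.IsSymm.norm_pow_le_trace {A : Matrix κ κ ℝ} (hA : A.IsSymm) {s : ℕ} (hs : s ≠ 0) :
    ‖A‖ ^ (2 * s) ≤ (A ^ (2 * s)).trace := by
  obtain ⟨l, h1, h2⟩ := hA.exists_trace_pow_eq
  rw [h1, h2]
  have hnn : ∀ i, 0 ≤ l i ^ (2 * s) := fun i => by rw [pow_mul]; positivity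
  rcases isEmpty_or_nonempty κ with h | h
  · rw [Pi.norm_def]; simp [hs]
  obtain ⟨i, hi⟩ : ∃ i, ‖l‖ = ‖l i‖ := by
    obtain ⟨i, -, hi⟩ := Finset.exists_mem_eq_sup' (Finset.univ_nonempty (α := κ)) fun i => ‖l i‖
    refine ⟨i, le_antisymm ?_ (norm_le_pi_norm l i)⟩
    rw [← hi, pi_norm_le_iff_of_nonempty]
    intro j
    exact Finset.le_sup' (fun i => ‖l i‖) (Finset.mem_univ j)
  rw [hi, pow_mul, Real.norm_eq_abs, sq_abs, ← pow_mul]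
  exact Finset.single_le_sum (fun i _ => hnn i) (Finset.mem_univ i)

theorem Matrix.IsSymm.trace_pow_le_norm {A : Matrix κ κ ℝ} (hA : A.IsSymm) (s : ℕ) :
    (A ^ (2 * s)).trace ≤ Fintype.card κ * ‖A‖ ^ (2 * s) := by
  obtain ⟨l, h1, h2⟩ := hA.exists_trace_pow_eq
  rw [h1, h2]
  calc ∑ i, l i ^ (2 * s) ≤ ∑ _i : κ, ‖l‖ ^ (2 * s) := by
        refine Finset.sum_le_sum fun i _ => ?_
        rw [pow_mul, ← sq_abs, ← pow_mul]
        exact pow_le_pow_left₀ (abs_nonneg _) (norm_le_pi_norm l i) _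
    _ = _ := by simp

theorem Matrix.IsSymm.norm_le_card_mul {A : Matrix κ κ ℝ} (hA : A.IsSymm) {c : ℝ} (hc : 0 ≤ c)
    (h : ∀ i j, |A i j| ≤ c) : ‖A‖ ≤ Fintype.card κ * c := by
  have h1 := hA.norm_pow_le_trace one_ne_zero
  refine le_of_sq_le_sq ?_ (by positivity)
  rw [mul_one] at h1
  refine h1.trans ?_
  calc (A ^ 2).trace = ∑ i, ∑ j, (A i j) ^ 2 := by
        rw [pow_two, Matrix.trace]
        refine Finset.sum_congr rfl fun i _ => ?_
        rw [Matrix.diag_apply, Matrix.mul_apply]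
        exact Finset.sum_congr rfl fun j _ => by rw [hA.apply i j, pow_two]
    _ ≤ ∑ _i : κ, ∑ _j : κ, c ^ 2 := by
        refine Finset.sum_le_sum fun i _ => Finset.sum_le_sum fun j _ => ?_
        rw [← sq_abs]
        exact pow_le_pow_left₀ (abs_nonneg _) (h i j) _
    _ = _ := by simp; ring

/-- Diagonalise W and Y in their own orthonormal bases; the weights are the squared entries of H
written between these two bases. They do not depend on p and q, so scalar inequalities for monomials
in the eigenvalues transfer to traces. -/
theorem trace_mul_pow_mul_pow_eq {H W Y : Matrix κ κ ℝ} (hH : H.IsSymm) (hW : W.IsSymm)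
    (hY : Y.IsSymm) : ∃ (g : κ → κ → ℝ) (l l' : κ → ℝ), (∀ i j, 0 ≤ g i j) ∧
      ∀ p q : ℕ, (H * W ^ p * (H * Y ^ q)).trace = ∑ i, ∑ j, g i j * (l i ^ p * l' j ^ q) := by
  obtain ⟨U, l, hU, -, hl⟩ := hW.exists_pow_eq_diagonal
  obtain ⟨V, l', hV, -, hl'⟩ := hY.exists_pow_eq_diagonal
  set G := U.transpose * H * V with hG
  have hGt : G.transpose = V.transpose * H * U := by
    rw [hG, Matrix.transpose_mul, Matrix.transpose_mul, Matrix.transpose_transpose, hH.eq,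
      Matrix.mul_assoc]
  refine ⟨fun i j => G i j ^ 2, l, l', fun i j => sq_nonneg _, fun p q => ?_⟩
  have : (H * W ^ p * (H * Y ^ q)).trace = (diagonal (fun i => l i ^ p) * G *
      (diagonal (fun j => l' j ^ q) * G.transpose)).trace := by
    rw [hl, hl', hGt, hG]
    calc _ = (H * U * (diagonal (fun i => l i ^ p) * (U.transpose * H * V) *
          (diagonal (fun j => l' j ^ q) * V.transpose))).trace := by
          simp only [Matrix.mul_assoc]
      _ = _ := by
          rw [Matrix.trace_mul_comm]
          simp only [Matrix.mul_assoc]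
  rw [this, Matrix.trace]
  refine Finset.sum_congr rfl fun i _ => ?_
  rw [Matrix.diag_apply, Matrix.mul_apply]
  refine Finset.sum_congr rfl fun j _ => ?_
  rw [Matrix.diagonal_mul, Matrix.diagonal_mul, Matrix.transpose_apply]
  ring

theorem pow_mul_pow_le_add {x y : ℝ} {p q r : ℕ} (h : p + q = 2 * r) :
    x ^ p * y ^ q ≤ x ^ (2 * r) + y ^ (2 * r) := by
  have key : ∀ z : ℝ, z ^ (2 * r) = |z| ^ (2 * r) := fun z => by
    rw [pow_mul, pow_mul, sq_abs]
  rw [key x, key y]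
  calc x ^ p * y ^ q ≤ |x| ^ p * |y| ^ q := by
        rw [← abs_pow, ← abs_pow, ← abs_mul]; exact le_abs_self _
    _ ≤ (max |x| |y|) ^ p * (max |x| |y|) ^ q := by
        gcongr
        · exact le_max_left _ _
        · exact le_max_right _ _
    _ = (max |x| |y|) ^ (2 * r) := by rw [← pow_add, h]
    _ ≤ _ := by
        rcases max_cases |x| |y| with h | h <;> rw [h.1]
        · exact le_add_of_nonneg_right (by positivity)
        · exact le_add_of_nonneg_left (by positivity)

theorem trace_mul_pow_mul_pow_le {H W Y : Matrix κ κ ℝ} (hH : H.IsSymm) (hW : W.IsSymm)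
    (hY : Y.IsSymm) {p q r : ℕ} (h : p + q = 2 * r) :
    (H * W ^ p * (H * Y ^ q)).trace ≤
      (H * H * W ^ (2 * r)).trace + (H * H * Y ^ (2 * r)).trace := by
  obtain ⟨g, l, l', hg, hf⟩ := trace_mul_pow_mul_pow_eq hH hW hY
  have h1 := hf (2 * r) 0
  have h2 := hf 0 (2 * r)
  rw [pow_zero, Matrix.mul_one, Matrix.trace_mul_comm, ← Matrix.mul_assoc] at h1
  rw [pow_zero, Matrix.mul_one, ← Matrix.mul_assoc] at h2
  rw [h1, h2, hf, ← Finset.sum_add_distrib]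
  refine Finset.sum_le_sum fun i _ => ?_
  rw [← Finset.sum_add_distrib]
  refine Finset.sum_le_sum fun j _ => ?_
  rw [← mul_add]
  refine mul_le_mul_of_nonneg_left ?_ (hg i j)
  simpa using pow_mul_pow_le_add h

theorem pow_sub_pow_eq_sum {R : Type*} [Ring R] (x y : R) (k : ℕ) :
    x ^ k - y ^ k = ∑ q ∈ Finset.range k, x ^ q * (x - y) * y ^ (k - 1 - q) := by
  induction k with
  | zero => simp
  | succ k ih =>
    rw [Finset.sum_range_succ]
    have : ∑ q ∈ Finset.range k, x ^ q * (x - y) * y ^ (k + 1 - 1 - q) =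
        (∑ q ∈ Finset.range k, x ^ q * (x - y) * y ^ (k - 1 - q)) * y := by
      rw [Finset.sum_mul]
      refine Finset.sum_congr rfl fun q hq => ?_
      rw [Finset.mem_range] at hq
      rw [mul_assoc _ _ y, ← pow_succ]
      congr 2
      omega
    rw [this, ← ih]
    simp only [Nat.add_sub_cancel, Nat.sub_self, pow_zero, mul_one, pow_succ]
    noncomm_ring

theorem Matrix.IsSymm.diag_pow_nonneg {A : Matrix κ κ ℝ} (hA : A.IsSymm) (s : ℕ) (i : κ) :
    0 ≤ (A ^ (2 * s)) i i := by
  have : A ^ (2 * s) = A ^ s * (A ^ s).transpose := by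
    rw [Matrix.transpose_pow, hA.eq, ← pow_add, two_mul]
  rw [this, Matrix.mul_apply]
  exact Finset.sum_nonneg fun j _ => by rw [Matrix.transpose_apply]; exact mul_self_nonneg _

/-- Noncommutative Khintchine inequality for Rademacher sums of symmetric matrices whose
squares add up to a diagonal matrix. -/
theorem sum_signs_trace_pow_le {ι : Type*} [Fintype ι] [DecidableEq ι] {A : ι → Matrix κ κ ℝ}
    (hA : ∀ e, (A e).IsSymm) {D : κ → ℝ} (hD : ∑ e, A e * A e = diagonal D) {V : ℝ}
    (hV : ∀ i, D i ≤ V) (s : ℕ) :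
    ∑ ε : ι → ℤˣ, ((∑ e, ((ε e : ℤ) : ℝ) • A e) ^ (2 * s)).trace ≤
      Fintype.card (ι → ℤˣ) * Fintype.card κ * (4 * s * V) ^ s := by
  set S : (ι → ℤˣ) → Matrix κ κ ℝ := fun ε => ∑ e, ((ε e : ℤ) : ℝ) • A e with hS
  have hSs : ∀ ε, (S ε).IsSymm := fun ε => by
    rw [Matrix.IsSymm, hS, Matrix.transpose_sum]
    exact Finset.sum_congr rfl fun e _ => by rw [Matrix.transpose_smul, (hA e).eq]
  rcases isEmpty_or_nonempty κ with hκ | ⟨⟨i₀⟩⟩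
  · simp [Matrix.trace]
  have hV0 : 0 ≤ V := by
    refine le_trans ?_ (hV i₀)
    have : D i₀ = (∑ e, A e * A e) i₀ i₀ := by rw [hD, Matrix.diagonal_apply_eq]
    rw [this, Matrix.sum_apply]
    refine Finset.sum_nonneg fun e _ => ?_
    have := (hA e).diag_pow_nonneg 1 i₀
    rwa [mul_one, pow_two] at this
  -- sign flip of one coordinate
  set fl : ι → (ι → ℤˣ) ≃ (ι → ℤˣ) := fun e => Equiv.mulLeft (Pi.mulSingle e (-1)) with hfl
  have hfle : ∀ e ε, (fl e ε) e = - ε e := fun e ε => by simp [hfl]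
  have hflS : ∀ e ε, S ε - S (fl e ε) = (2 * ((ε e : ℤ) : ℝ)) • A e := fun e ε => by
    rw [hS]
    simp only
    rw [← Finset.sum_sub_distrib, Finset.sum_eq_single e]
    · rw [hfle, ← sub_smul]; congr 1; push_cast; ring
    · intro e' _ he'
      have : fl e ε e' = ε e' := by simp [hfl, he']
      rw [this, sub_self]
    · simp
  have hsq : ∀ u : ℤˣ, ((u : ℤ) : ℝ) * ((u : ℤ) : ℝ) = 1 := fun u => by
    rcases Int.units_eq_one_or u with h | h <;> simp [h]
  -- Discrete integration by parts: one factor S is expanded into its summands, and in the e-th term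
  -- the sign e is flipped. Averaging over the flip leaves the difference of S^(2r+1) and its
  -- flipped version, which telescopes into 2r + 1 terms, each containing a second copy of `A e`.
  have step : ∀ r : ℕ, ∑ ε, (S ε ^ (2 * (r + 1))).trace ≤
      2 * (2 * r + 1) * V * ∑ ε, (S ε ^ (2 * r)).trace := by
    intro r
    have hone : ∀ e, ∑ ε, ((ε e : ℤ) : ℝ) * (A e * S ε ^ (2 * r + 1)).trace ≤
        2 * (2 * r + 1) * ∑ ε, (A e * A e * S ε ^ (2 * r)).trace := by
      intro e
      have h1 : ∑ ε, ((ε e : ℤ) : ℝ) * (A e * S ε ^ (2 * r + 1)).trace =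
          ∑ ε, -((ε e : ℤ) : ℝ) * (A e * S (fl e ε) ^ (2 * r + 1)).trace := by
        rw [← Equiv.sum_comp (fl e)]
        refine Finset.sum_congr rfl fun ε _ => ?_
        rw [hfle]; push_cast; ring
      have h2 : 2 * ∑ ε, ((ε e : ℤ) : ℝ) * (A e * S ε ^ (2 * r + 1)).trace =
          ∑ ε, ((ε e : ℤ) : ℝ) *
            (A e * (S ε ^ (2 * r + 1) - S (fl e ε) ^ (2 * r + 1))).trace := by
        rw [two_mul]
        nth_rewrite 2 [h1]
        rw [← Finset.sum_add_distrib]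
        refine Finset.sum_congr rfl fun ε _ => ?_
        rw [Matrix.mul_sub, Matrix.trace_sub]; ring
      have h3 : ∀ ε, ((ε e : ℤ) : ℝ) *
            (A e * (S ε ^ (2 * r + 1) - S (fl e ε) ^ (2 * r + 1))).trace ≤
          2 * ((2 * r + 1) * ((A e * A e * S ε ^ (2 * r)).trace +
            (A e * A e * S (fl e ε) ^ (2 * r)).trace)) := by
        intro ε
        rw [pow_sub_pow_eq_sum, Finset.mul_sum, Matrix.trace_sum, Finset.mul_sum]
        calc _ = ∑ q ∈ Finset.range (2 * r + 1),
              2 * (A e * S ε ^ q * (A e * S (fl e ε) ^ (2 * r - q))).trace := by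
              refine Finset.sum_congr rfl fun q _ => ?_
              rw [hflS, Matrix.mul_smul, Matrix.smul_mul, Matrix.mul_smul, Matrix.trace_smul,
                smul_eq_mul, ← mul_assoc, mul_left_comm, hsq, mul_one, Nat.add_sub_cancel]
              simp only [Matrix.mul_assoc]
          _ ≤ ∑ _q ∈ Finset.range (2 * r + 1), 2 * ((A e * A e * S ε ^ (2 * r)).trace +
                (A e * A e * S (fl e ε) ^ (2 * r)).trace) := by
              refine Finset.sum_le_sum fun q hq => ?_
              rw [Finset.mem_range] at hq
              have := trace_mul_pow_mul_pow_le (hA e) (hSs ε) (hSs (fl e ε))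
                (p := q) (q := 2 * r - q) (r := r) (by omega)
              linarith
          _ = _ := by
              rw [Finset.sum_const, Finset.card_range, nsmul_eq_mul]; push_cast; ring
      have h4 := Finset.sum_le_sum fun ε (_ : ε ∈ Finset.univ) => h3 ε
      rw [← h2, ← Finset.mul_sum, ← Finset.mul_sum, Finset.sum_add_distrib,
        Equiv.sum_comp (fl e) (fun ε => (A e * A e * S ε ^ (2 * r)).trace)] at h4
      linarith
    calc ∑ ε, (S ε ^ (2 * (r + 1))).trace
        = ∑ ε, ∑ e, ((ε e : ℤ) : ℝ) * (A e * S ε ^ (2 * r + 1)).trace := by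
          refine Finset.sum_congr rfl fun ε _ => ?_
          rw [show 2 * (r + 1) = (2 * r + 1) + 1 by ring, pow_succ']
          nth_rewrite 1 [hS]
          simp only
          rw [Finset.sum_mul, Matrix.trace_sum]
          exact Finset.sum_congr rfl fun e _ => by
            rw [Matrix.smul_mul, Matrix.trace_smul, smul_eq_mul]
      _ = ∑ e, ∑ ε, ((ε e : ℤ) : ℝ) * (A e * S ε ^ (2 * r + 1)).trace := Finset.sum_comm
      _ ≤ ∑ e, 2 * (2 * r + 1) * ∑ ε, (A e * A e * S ε ^ (2 * r)).trace :=
          Finset.sum_le_sum fun e _ => hone e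
      _ = 2 * (2 * r + 1) * ∑ ε, (diagonal D * S ε ^ (2 * r)).trace := by
          rw [← Finset.mul_sum, Finset.sum_comm]
          congr 1
          refine Finset.sum_congr rfl fun ε _ => ?_
          rw [← hD, Finset.sum_mul, Matrix.trace_sum]
      -- Since the sum of squares is diagonal, comparing it with V only needs the diagonal of an
      -- even power to be nonnegative.
      _ ≤ 2 * (2 * r + 1) * ∑ ε, V * (S ε ^ (2 * r)).trace := by
          refine mul_le_mul_of_nonneg_left (Finset.sum_le_sum fun ε _ => ?_) (by positivity)
          rw [Matrix.trace, Matrix.trace, Finset.mul_sum]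
          refine Finset.sum_le_sum fun i _ => ?_
          rw [Matrix.diag_apply, Matrix.diag_apply, Matrix.diagonal_mul]
          exact mul_le_mul_of_nonneg_right (hV i) ((hSs ε).diag_pow_nonneg r i)
      _ = _ := by rw [← Finset.mul_sum]; ring
  have main : ∀ r : ℕ, r ≤ s → ∑ ε, (S ε ^ (2 * r)).trace ≤
      Fintype.card (ι → ℤˣ) * Fintype.card κ * (4 * s * V) ^ r := by
    intro r
    induction r with
    | zero => intro _; simp [Matrix.trace_one]
    | succ r ih =>
      intro hr
      have h1 : (r : ℝ) + 1 ≤ s := by exact_mod_cast hr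
      calc _ ≤ 2 * (2 * r + 1) * V * ∑ ε, (S ε ^ (2 * r)).trace := step r
        _ ≤ (4 * s * V) * (Fintype.card (ι → ℤˣ) * Fintype.card κ * (4 * s * V) ^ r) := by
            refine mul_le_mul ?_ (ih (by omega)) ?_ (by positivity)
            · exact mul_le_mul_of_nonneg_right (by linarith) hV0
            · exact Finset.sum_nonneg fun ε _ =>
                Finset.sum_nonneg fun i _ => (hSs ε).diag_pow_nonneg r i
        _ = _ := by ring
  exact main s le_rfl

end LinearAlgebra

/-! ### Norm moments for independent, symmetrically distributed, bounded entries. -/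

section SymmetricProduct

open Matrix
open scoped Matrix.Norms.L2Operator

theorem integrable_of_continuous_of_ae_norm_le {E F : Type*} [NormedAddCommGroup E]
    [ProperSpace E] [MeasurableSpace E] [BorelSpace E] [SecondCountableTopology E]
    [NormedAddCommGroup F] {P : Measure E} [IsFiniteMeasure P]
    {f : E → F} (hf : Continuous f) {K : ℝ} (hK : ∀ᵐ x ∂P, ‖x‖ ≤ K) : Integrable f P := by
  obtain ⟨M, hM⟩ := (isCompact_closedBall (0 : E) K).exists_bound_of_continuousOn hf.continuousOn
  refine Integrable.of_bound hf.aestronglyMeasurable M ?_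
  filter_upwards [hK] with x hx
  exact hM x (by simpa using hx)

theorem ae_pi_norm_le {ι : Type*} [Fintype ι] {ρ : ι → Measure ℝ} [∀ e, IsProbabilityMeasure (ρ e)]
    {K : ℝ} (hK : 0 ≤ K) (h : ∀ e, ∀ᵐ x ∂ρ e, |x| ≤ K) : ∀ᵐ z ∂Measure.pi ρ, ‖z‖ ≤ K := by
  have : ∀ e, ∀ᵐ z ∂Measure.pi ρ, |z e| ≤ K := fun e =>
    (Measure.tendsto_eval_ae_ae (μ := ρ) (i := e)).eventually (h e)
  filter_upwards [ae_all_iff.2 this] with z hz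
  exact (pi_norm_le_iff_of_nonneg hK).2 hz

theorem exp_le_one_add_two_mul {u : ℝ} (h0 : 0 ≤ u) (h1 : u ≤ 1) : Real.exp u ≤ 1 + 2 * u := by
  have := Real.abs_exp_sub_one_sub_id_le (x := u) (by rw [abs_of_nonneg h0]; exact h1)
  have := (abs_le.1 this).2
  nlinarith

variable {ι : Type*} [Fintype ι]

/-- The s-th power is dominated by s! times an exponential, which factorises under the product
measure. At most 2c coordinates, each with second moment at most Λ/c, contribute total exponent at
most 4. -/
theorem integral_sum_sq_pow_le [DecidableEq ι] {ρ : ι → Measure ℝ} [∀ e, IsProbabilityMeasure (ρ e)]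
    {K Λ : ℝ} (hK : 0 ≤ K) (hΛ : 0 < Λ) (hKΛ : K ^ 2 ≤ Λ) (hρ : ∀ e, ∀ᵐ x ∂ρ e, |x| ≤ K)
    {S : Finset ι} {c : ℕ} (hS : S.card ≤ 2 * c) (hv : ∀ e, c * ∫ x, x ^ 2 ∂ρ e ≤ Λ) (s : ℕ) :
    ∫ z, (∑ e ∈ S, z e ^ 2) ^ s ∂Measure.pi ρ ≤ Real.exp 4 * (s * Λ) ^ s := by
  have hn := ae_pi_norm_le hK hρ
  -- Coordinates outside S receive the factor 1 so that the product runs over all coordinates and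
  -- matches the product measure.
  have h1 : ∀ z : ι → ℝ, (∑ e ∈ S, z e ^ 2) ^ s ≤
      (s * Λ) ^ s * ∏ e, (if e ∈ S then Real.exp (z e ^ 2 / Λ) else 1) := by
    intro z
    have hnn : 0 ≤ (∑ e ∈ S, z e ^ 2) / Λ := by positivity
    have h := Real.pow_div_factorial_le_exp _ hnn s
    rw [div_le_iff₀ (by positivity), div_pow, div_le_iff₀ (by positivity), Finset.sum_div,
      Real.exp_sum] at h
    rw [Finset.prod_ite_mem, Finset.univ_inter, mul_pow]
    refine h.trans ?_
    have hfac : (s.factorial : ℝ) ≤ (s : ℝ) ^ s := by exact_mod_cast Nat.factorial_le_pow s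
    have hprod : 0 ≤ ∏ e ∈ S, Real.exp (z e ^ 2 / Λ) :=
      Finset.prod_nonneg fun e _ => (Real.exp_pos _).le
    calc _ ≤ (∏ e ∈ S, Real.exp (z e ^ 2 / Λ)) * (s : ℝ) ^ s * Λ ^ s := by gcongr
      _ = _ := by ring
  have hexp : ∀ e, ∫ x, (if e ∈ S then Real.exp (x ^ 2 / Λ) else 1) ∂ρ e ≤
      if e ∈ S then Real.exp (2 * (∫ x, x ^ 2 ∂ρ e) / Λ) else 1 := by
    intro e
    split_ifs with he
    · calc ∫ x, Real.exp (x ^ 2 / Λ) ∂ρ e ≤ ∫ x, (1 + 2 / Λ * x ^ 2) ∂ρ e := by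
            refine integral_mono_ae
              (integrable_of_continuous_of_ae_norm_le (by fun_prop) (hρ e))
              (integrable_of_continuous_of_ae_norm_le (by fun_prop) (hρ e)) ?_
            filter_upwards [hρ e] with x hx
            have hx2 : x ^ 2 ≤ Λ := by
              rw [← sq_abs]; exact (pow_le_pow_left₀ (abs_nonneg _) hx 2).trans hKΛ
            refine (exp_le_one_add_two_mul (by positivity) ((div_le_one hΛ).2 hx2)).trans ?_
            rw [div_mul_eq_mul_div, mul_div_assoc]
        _ = 1 + 2 * (∫ x, x ^ 2 ∂ρ e) / Λ := by
            rw [integral_add (integrable_const _)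
              (integrable_of_continuous_of_ae_norm_le (by fun_prop) (hρ e)), integral_const_mul]
            simp only [integral_const, probReal_univ, smul_eq_mul, mul_one]
            ring
        _ ≤ _ := by rw [add_comm]; exact Real.add_one_le_exp _
    · simp
  have hcont : Continuous fun z : ι → ℝ =>
      ∏ e, (if e ∈ S then Real.exp (z e ^ 2 / Λ) else 1) := by
    refine continuous_finsetProd _ fun e _ => ?_
    split_ifs <;> fun_prop
  calc ∫ z, (∑ e ∈ S, z e ^ 2) ^ s ∂Measure.pi ρ
      ≤ ∫ z, (s * Λ) ^ s * ∏ e, (if e ∈ S then Real.exp (z e ^ 2 / Λ) else 1) ∂Measure.pi ρ :=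
        integral_mono (integrable_of_continuous_of_ae_norm_le (by fun_prop) hn)
          ((integrable_of_continuous_of_ae_norm_le hcont hn).const_mul _) h1
    _ = (s * Λ) ^ s * ∏ e, ∫ x, (if e ∈ S then Real.exp (x ^ 2 / Λ) else 1) ∂ρ e := by
        rw [integral_const_mul, integral_fintype_prod_eq_prod
          (fun e (x : ℝ) => if e ∈ S then Real.exp (x ^ 2 / Λ) else 1)]
    _ ≤ (s * Λ) ^ s * ∏ e, (if e ∈ S then Real.exp (2 * (∫ x, x ^ 2 ∂ρ e) / Λ) else 1) := by
        refine mul_le_mul_of_nonneg_left (Finset.prod_le_prod (fun e _ => ?_) fun e _ => hexp e)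
          (by positivity)
        exact integral_nonneg fun x => by dsimp only; split_ifs <;> positivity
    _ ≤ (s * Λ) ^ s * Real.exp 4 := by
        refine mul_le_mul_of_nonneg_left ?_ (by positivity)
        rw [Finset.prod_ite_mem, Finset.univ_inter, ← Real.exp_sum, Real.exp_le_exp]
        rcases Nat.eq_zero_or_pos c with hc | hc
        · have : S = ∅ := Finset.card_eq_zero.1 (by omega)
          simp [this]
        · have hc' : (0 : ℝ) < c := by exact_mod_cast hc
          calc ∑ e ∈ S, 2 * (∫ x, x ^ 2 ∂ρ e) / Λ ≤ ∑ _e ∈ S, 2 / (c : ℝ) := by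
                refine Finset.sum_le_sum fun e _ => ?_
                rw [div_le_div_iff₀ hΛ hc']
                linarith [hv e]
            _ = S.card * (2 / (c : ℝ)) := by rw [Finset.sum_const, nsmul_eq_mul]
            _ ≤ (2 * c : ℝ) * (2 / (c : ℝ)) := by
                refine mul_le_mul_of_nonneg_right ?_ (by positivity)
                exact_mod_cast hS
            _ = 4 := by field_simp; norm_num
    _ = _ := mul_comm _ _

theorem map_units_mul_eq {ρ : Measure ℝ} (hρ : ρ.map (fun x => -x) = ρ) (u : ℤˣ) :
    ρ.map (fun x => ((u : ℤ) : ℝ) * x) = ρ := by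
  rcases Int.units_eq_one_or u with h | h
  · simp [h]
  · simpa [h] using hρ

theorem integral_units_mul_pi_eq {ρ : ι → Measure ℝ} [∀ e, IsProbabilityMeasure (ρ e)]
    (hρ : ∀ e, (ρ e).map (fun x => -x) = ρ e) {F : (ι → ℝ) → ℝ} (hF : Continuous F)
    (ε : ι → ℤˣ) :
    ∫ z, F (fun e => ((ε e : ℤ) : ℝ) * z e) ∂Measure.pi ρ = ∫ z, F z ∂Measure.pi ρ := by
  have h : (Measure.pi ρ).map (fun z e => ((ε e : ℤ) : ℝ) * z e) = Measure.pi ρ := by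
    have : ∀ e, (ρ e).map (fun x => ((ε e : ℤ) : ℝ) * x) = ρ e := fun e =>
      map_units_mul_eq (hρ e) (ε e)
    have hp : ∀ e, IsProbabilityMeasure ((ρ e).map (fun x => ((ε e : ℤ) : ℝ) * x)) := fun e => by
      rw [this e]; infer_instance
    rw [Measure.pi_map_pi (f := fun e x => ((ε e : ℤ) : ℝ) * x) fun e => by fun_prop]
    simp_rw [this]
  conv_rhs => rw [← h]
  rw [integral_map (measurable_pi_lambda _ fun e => (measurable_pi_apply e).const_mul _).aemeasurable
    hF.aestronglyMeasurable]

/-- Moment bound for the norm of a random symmetric matrix with independent symmetrically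
distributed bounded entries. -/
theorem integral_norm_pow_le_of_symmetric [DecidableEq ι] {n : ℕ} {ρ : ι → Measure ℝ}
    [∀ e, IsProbabilityMeasure (ρ e)] (hρs : ∀ e, (ρ e).map (fun x => -x) = ρ e)
    {K Λ : ℝ} (hK : 0 ≤ K) (hΛ : 0 < Λ) (hKΛ : K ^ 2 ≤ Λ) (hρ : ∀ e, ∀ᵐ x ∂ρ e, |x| ≤ K)
    (hv : ∀ e, n * ∫ x, x ^ 2 ∂ρ e ≤ Λ) {B : ι → Matrix (Fin n) (Fin n) ℝ}
    (hB : ∀ e, (B e).IsSymm) {inc : Fin n → Finset ι} (hinc : ∀ k, (inc k).card ≤ 2 * n)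
    (hBB : ∀ e, B e * B e = diagonal fun k => if e ∈ inc k then 1 else 0) {s : ℕ} (hs : s ≠ 0) :
    ∫ z, ‖∑ e, z e • B e‖ ^ (2 * s) ∂Measure.pi ρ ≤
      Real.exp 4 * n ^ 2 * (4 * s ^ 2 * Λ) ^ s := by
  have hn := ae_pi_norm_le hK hρ
  set F : (ι → ℝ) → ℝ := fun z => ‖∑ e, z e • B e‖ ^ (2 * s) with hF
  have hFc : Continuous F := by fun_prop
  set R : (ι → ℝ) → Fin n → ℝ := fun z k => ∑ e ∈ inc k, z e ^ 2 with hR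
  have hR0 : ∀ z k, 0 ≤ R z k := fun z k => Finset.sum_nonneg fun e _ => sq_nonneg _
  have hRc : ∀ k, Continuous fun z => R z k := fun k => by fun_prop
  have hsym : ∀ z : ι → ℝ, (∑ e, z e • B e).IsSymm := fun z => by
    rw [Matrix.IsSymm, Matrix.transpose_sum]
    exact Finset.sum_congr rfl fun e _ => by rw [Matrix.transpose_smul, (hB e).eq]
  -- For fixed z, Khintchine applies over the signs with variance parameter the largest row sum of
  -- squares. One factor n comes from the trace; bounding the maximum over rows by a sum later
  -- yields the second.
  have hpt : ∀ z : ι → ℝ, ∑ ε : ι → ℤˣ, F (fun e => ((ε e : ℤ) : ℝ) * z e) ≤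
      Fintype.card (ι → ℤˣ) * (n * (4 * s) ^ s * ∑ k, R z k ^ s) := by
    intro z
    have hnorm : ‖R z‖ ^ s ≤ ∑ k, R z k ^ s := by
      rcases isEmpty_or_nonempty (Fin n) with h | h
      · rw [Pi.norm_def]; simp [hs]
      obtain ⟨i, -, hi⟩ := Finset.exists_mem_eq_sup' (Finset.univ_nonempty (α := Fin n))
        fun i => ‖R z i‖
      have hi' : ‖R z‖ ≤ R z i := by
        rw [← Real.norm_of_nonneg (hR0 z i), ← hi, pi_norm_le_iff_of_nonempty]
        exact fun j => Finset.le_sup' (fun i => ‖R z i‖) (Finset.mem_univ j)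
      exact (pow_le_pow_left₀ (norm_nonneg _) hi' s).trans
        (Finset.single_le_sum (f := fun k => R z k ^ s) (fun k _ => pow_nonneg (hR0 z k) s)
          (Finset.mem_univ i))
    have hD : ∑ e, (z e • B e) * (z e • B e) = diagonal (R z) := by
      have h1 : ∀ e, (z e • B e) * (z e • B e) =
          diagonal fun k => if e ∈ inc k then z e ^ 2 else 0 := fun e => by
        rw [Matrix.smul_mul, Matrix.mul_smul, hBB, smul_smul, ← Matrix.diagonal_smul]
        congr 1
        ext k
        simp [pow_two]
      simp_rw [h1]
      ext k l
      rw [Matrix.sum_apply]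
      by_cases hkl : k = l
      · subst hkl
        simp [hR, Finset.sum_ite_mem]
      · simp [hkl]
    have hkh := sum_signs_trace_pow_le (A := fun e => z e • B e)
      (fun e => by rw [Matrix.IsSymm, Matrix.transpose_smul, (hB e).eq]) hD (V := ‖R z‖)
      (fun i => (le_abs_self _).trans (norm_le_pi_norm (R z) i)) s
    calc ∑ ε : ι → ℤˣ, F (fun e => ((ε e : ℤ) : ℝ) * z e)
        ≤ ∑ ε : ι → ℤˣ, ((∑ e, ((ε e : ℤ) : ℝ) • z e • B e) ^ (2 * s)).trace := by
          refine Finset.sum_le_sum fun ε _ => ?_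
          refine ((hsym _).norm_pow_le_trace hs).trans_eq ?_
          simp only [smul_smul]
      _ ≤ _ := hkh
      _ = Fintype.card (ι → ℤˣ) * (n * (4 * s) ^ s * ‖R z‖ ^ s) := by
          rw [Fintype.card_fin, mul_pow _ ‖R z‖]; ring
      _ ≤ _ := by gcongr
  have hcard : (0 : ℝ) < Fintype.card (ι → ℤˣ) := by exact_mod_cast Fintype.card_pos
  refine le_of_mul_le_mul_left ?_ hcard
  calc (Fintype.card (ι → ℤˣ) : ℝ) * ∫ z, F z ∂Measure.pi ρ
      = ∑ ε : ι → ℤˣ, ∫ z, F (fun e => ((ε e : ℤ) : ℝ) * z e) ∂Measure.pi ρ := by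
        rw [Finset.sum_congr rfl fun ε _ => integral_units_mul_pi_eq hρs hFc ε, Finset.sum_const,
          Finset.card_univ, nsmul_eq_mul]
    _ = ∫ z, ∑ ε : ι → ℤˣ, F (fun e => ((ε e : ℤ) : ℝ) * z e) ∂Measure.pi ρ := by
        rw [integral_finsetSum]
        intro ε _
        exact integrable_of_continuous_of_ae_norm_le (by fun_prop) hn
    _ ≤ ∫ z, Fintype.card (ι → ℤˣ) * (n * (4 * s) ^ s * ∑ k, R z k ^ s) ∂Measure.pi ρ :=
        integral_mono (integrable_of_continuous_of_ae_norm_le (by fun_prop) hn)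
          (integrable_of_continuous_of_ae_norm_le (by fun_prop) hn) hpt
    _ = Fintype.card (ι → ℤˣ) * (n * (4 * s) ^ s * ∑ k, ∫ z, R z k ^ s ∂Measure.pi ρ) := by
        rw [integral_const_mul, integral_const_mul, integral_finsetSum]
        intro k _
        exact integrable_of_continuous_of_ae_norm_le (by fun_prop) hn
    _ ≤ Fintype.card (ι → ℤˣ) * (n * (4 * s) ^ s * ∑ _k : Fin n, Real.exp 4 * (s * Λ) ^ s) := by
        gcongr with k _
        exact integral_sum_sq_pow_le hK hΛ hKΛ hρ (hinc k) hv s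
    _ = _ := by
        rw [Finset.sum_const, Finset.card_univ, Fintype.card_fin, nsmul_eq_mul,
          show (4 * (s : ℝ) ^ 2 * Λ) = (4 * s) * (s * Λ) by ring, mul_pow (4 * (s : ℝ)) (s * Λ)]
        ring

end SymmetricProduct

/-! ### Passing from independent entries to symmetric ones. -/

section Symmetrization

variable {ι : Type*} [Fintype ι]

/-- The law of the difference of two independent variables with law `ν`. -/
noncomputable def symmetrizedLaw (ν : Measure ℝ) : Measure ℝ := (ν.prod ν).map fun p => p.1 - p.2

instance (ν : Measure ℝ) [IsProbabilityMeasure ν] : IsProbabilityMeasure (symmetrizedLaw ν) :=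
  Measure.isProbabilityMeasure_map (by fun_prop)

theorem symmetrizedLaw_map_neg (ν : Measure ℝ) [IsProbabilityMeasure ν] :
    (symmetrizedLaw ν).map (fun x => -x) = symmetrizedLaw ν := by
  rw [symmetrizedLaw, Measure.map_map (by fun_prop) (by fun_prop)]
  conv_rhs => rw [← Measure.prod_swap, Measure.map_map (by fun_prop) (by fun_prop)]
  congr 1
  ext p
  simp

theorem ae_prod_abs_le {ν : Measure ℝ} [IsProbabilityMeasure ν] {K : ℝ}
    (h : ∀ᵐ x ∂ν, |x| ≤ K) : ∀ᵐ p ∂ν.prod ν, |p.1| ≤ K ∧ |p.2| ≤ K := by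
  filter_upwards [Measure.quasiMeasurePreserving_fst.ae h,
    Measure.quasiMeasurePreserving_snd.ae h] with p h1 h2
  exact ⟨h1, h2⟩

theorem symmetrizedLaw_ae_le {ν : Measure ℝ} [IsProbabilityMeasure ν] {K : ℝ}
    (h : ∀ᵐ x ∂ν, |x| ≤ K) : ∀ᵐ x ∂symmetrizedLaw ν, |x| ≤ 2 * K := by
  rw [symmetrizedLaw, ae_map_iff (by fun_prop) (measurableSet_le (by fun_prop) (by fun_prop))]
  filter_upwards [ae_prod_abs_le h] with p hp
  calc |p.1 - p.2| ≤ |p.1| + |p.2| := abs_sub _ _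
    _ ≤ _ := by linarith [hp.1, hp.2]

theorem symmetrizedLaw_integral_sq_le {ν : Measure ℝ} [IsProbabilityMeasure ν] {K : ℝ}
    (h : ∀ᵐ x ∂ν, |x| ≤ K) :
    ∫ x, x ^ 2 ∂symmetrizedLaw ν ≤ 4 * ∫ x, x ^ 2 ∂ν := by
  have hb : ∀ᵐ p ∂ν.prod ν, ‖p‖ ≤ K := by
    filter_upwards [ae_prod_abs_le h] with p hp
    exact max_le hp.1 hp.2
  rw [symmetrizedLaw, integral_map (by fun_prop) (by fun_prop)]
  calc ∫ p, (p.1 - p.2) ^ 2 ∂ν.prod ν ≤ ∫ p, (2 * p.1 ^ 2 + 2 * p.2 ^ 2) ∂ν.prod ν :=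
        integral_mono (integrable_of_continuous_of_ae_norm_le (by fun_prop) hb)
          (integrable_of_continuous_of_ae_norm_le (by fun_prop) hb)
          fun p => by dsimp only; nlinarith [sq_nonneg (p.1 + p.2)]
    _ = _ := by
        rw [integral_add (integrable_of_continuous_of_ae_norm_le (by fun_prop) hb)
          (integrable_of_continuous_of_ae_norm_le (by fun_prop) hb), integral_const_mul,
          integral_const_mul, integral_fun_fst (fun x : ℝ => x ^ 2),
          integral_fun_snd (fun x : ℝ => x ^ 2)]
        simp
        ring

/-- A product of pairs is a pair of products, so symmetrizing coordinate by coordinate amounts to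
subtracting an independent copy of the whole vector. -/
theorem integral_pi_symmetrizedLaw {ν : ι → Measure ℝ} [∀ e, IsProbabilityMeasure (ν e)]
    {F : (ι → ℝ) → ℝ} (hF : Continuous F) :
    ∫ z, F z ∂Measure.pi (fun e => symmetrizedLaw (ν e)) =
      ∫ p, F (p.1 - p.2) ∂(Measure.pi ν).prod (Measure.pi ν) := by
  have hmp := measurePreserving_arrowProdEquivProdArrow ℝ ℝ ι ν ν
  rw [← hmp.map_eq, integral_map (by fun_prop) (by fun_prop)]
  have hp : ∀ e, IsProbabilityMeasure (((ν e).prod (ν e)).map fun p : ℝ × ℝ => p.1 - p.2) :=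
    fun e => Measure.isProbabilityMeasure_map (by fun_prop)
  have := Measure.pi_map_pi (μ := fun e => (ν e).prod (ν e))
    (f := fun (_ : ι) (p : ℝ × ℝ) => p.1 - p.2) fun e => by fun_prop
  simp only [symmetrizedLaw]
  rw [← this, integral_map (by fun_prop) (by fun_prop)]
  rfl

theorem pow_integral_le_integral_pow {α : Type*} [MeasurableSpace α] {P : Measure α}
    [IsProbabilityMeasure P] {f : α → ℝ} (h0 : ∀ x, 0 ≤ f x) (hf : Integrable f P) (k : ℕ)
    (hfk : Integrable (fun x => f x ^ k) P) : (∫ x, f x ∂P) ^ k ≤ ∫ x, f x ^ k ∂P :=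
  (convexOn_pow k).map_integral_le (by fun_prop) isClosed_Ici (ae_of_all _ h0) hf hfk

/-- Symmetrization: moments of a random sum are bounded by the mean and the symmetrized sum. -/
theorem integral_norm_pow_le_symmetrized {F : Type*} [NormedAddCommGroup F] [NormedSpace ℝ F]
    [CompleteSpace F] {ν : ι → Measure ℝ} [∀ e, IsProbabilityMeasure (ν e)] {K : ℝ} (hK : 0 ≤ K)
    (hν : ∀ e, ∀ᵐ x ∂ν e, |x| ≤ K) (T : ι → F) (k : ℕ) :
    ∫ y, ‖∑ e, y e • T e‖ ^ k ∂Measure.pi ν ≤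
      2 ^ k * (‖∑ e, (∫ x, x ∂ν e) • T e‖ ^ k +
        ∫ z, ‖∑ e, z e • T e‖ ^ k ∂Measure.pi (fun e => symmetrizedLaw (ν e))) := by
  have hn := ae_pi_norm_le hK hν
  set P := Measure.pi ν with hP
  set S : (ι → ℝ) → F := fun y => ∑ e, y e • T e with hS
  have hSc : Continuous S := by fun_prop
  have hn2 : ∀ᵐ p ∂P.prod P, ‖p‖ ≤ K := by
    filter_upwards [Measure.quasiMeasurePreserving_fst.ae hn,
      Measure.quasiMeasurePreserving_snd.ae hn] with p h1 h2
    exact max_le h1 h2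
  have hint : ∀ e, ∫ y, y e ∂P = ∫ x, x ∂ν e := fun e => by
    have := integral_comp_eval (μ := ν) (i := e) (f := fun x : ℝ => x)
      aestronglyMeasurable_id
    exact this
  have hmean : ∫ y, S y ∂P = ∑ e, (∫ x, x ∂ν e) • T e := by
    rw [hS, integral_finsetSum _ fun e _ =>
      integrable_of_continuous_of_ae_norm_le (by fun_prop) hn]
    exact Finset.sum_congr rfl fun e _ => by rw [integral_smul_const, hint]
  -- S y is its mean plus the average of S (y - y') over an independent copy y'; Jensen moves the
  -- power inside that average.
  have hpt : ∀ y, ‖S y‖ ^ k ≤ 2 ^ k * (‖∫ y, S y ∂P‖ ^ k + ∫ y', ‖S (y - y')‖ ^ k ∂P) := by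
    intro y
    have h1 : S y = ∫ y, S y ∂P + ∫ y', S (y - y') ∂P := by
      have : ∀ y', S (y - y') = S y - S y' := fun y' => by
        simp only [hS, Pi.sub_apply, sub_smul, Finset.sum_sub_distrib]
      simp_rw [this]
      rw [integral_sub (integrable_const _) (integrable_of_continuous_of_ae_norm_le hSc hn)]
      simp
    calc ‖S y‖ ^ k ≤ (‖∫ y, S y ∂P‖ + ∫ y', ‖S (y - y')‖ ∂P) ^ k := by
          refine pow_le_pow_left₀ (norm_nonneg _) ?_ k
          conv_lhs => rw [h1]
          exact (norm_add_le _ _).trans (by gcongr; exact norm_integral_le_integral_norm _)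
      _ ≤ 2 ^ (k - 1) * (‖∫ y, S y ∂P‖ ^ k + (∫ y', ‖S (y - y')‖ ∂P) ^ k) :=
          add_pow_le (norm_nonneg _) (integral_nonneg fun _ => norm_nonneg _) k
      _ ≤ 2 ^ k * (‖∫ y, S y ∂P‖ ^ k + ∫ y', ‖S (y - y')‖ ^ k ∂P) := by
          have : 0 ≤ ∫ y', ‖S (y - y')‖ ∂P := integral_nonneg fun _ => norm_nonneg _
          gcongr
          · norm_num
          · omega
          · exact pow_integral_le_integral_pow (fun _ => norm_nonneg _)
              (integrable_of_continuous_of_ae_norm_le (by fun_prop) hn) k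
              (integrable_of_continuous_of_ae_norm_le (by fun_prop) hn)
  have hprod : Integrable (fun p : (ι → ℝ) × (ι → ℝ) => ‖S (p.1 - p.2)‖ ^ k) (P.prod P) :=
    integrable_of_continuous_of_ae_norm_le (by fun_prop) hn2
  rw [integral_pi_symmetrizedLaw (F := fun z => ‖S z‖ ^ k) (by fun_prop), integral_prod _ hprod,
    ← hmean]
  calc ∫ y, ‖S y‖ ^ k ∂P
      ≤ ∫ y, 2 ^ k * (‖∫ y, S y ∂P‖ ^ k + ∫ y', ‖S (y - y')‖ ^ k ∂P) ∂P :=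
        integral_mono (integrable_of_continuous_of_ae_norm_le (by fun_prop) hn)
          (((integrable_const _).add hprod.integral_prod_left).const_mul _) hpt
    _ = _ := by
        rw [integral_const_mul, integral_add (integrable_const _) hprod.integral_prod_left]
        simp

end Symmetrization

/-! ### Symmetric matrix units and residue classes of positions. -/

section MatrixDecomposition

open Matrix
open scoped Matrix.Norms.L2Operator

/-- The symmetric matrix unit carried by the unordered pair of indices `{e.1, e.2}`. -/
def pairMatrix {n : ℕ} (e : Fin n × Fin n) : Matrix (Fin n) (Fin n) ℝ :=
  Matrix.of fun k l => if (min k l, max k l) = e then 1 else 0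

theorem pairMatrix_isSymm {n : ℕ} (e : Fin n × Fin n) : (pairMatrix e).IsSymm := by
  ext k l
  simp only [pairMatrix, Matrix.transpose_apply, Matrix.of_apply, min_comm, max_comm]

theorem min_max_eq_iff {n : ℕ} {e : Fin n × Fin n} (he : e.1 ≤ e.2) (k j : Fin n) :
    (min k j, max k j) = e ↔ (k = e.1 ∧ j = e.2) ∨ (k = e.2 ∧ j = e.1) := by
  rw [Prod.ext_iff]
  rcases le_total k j with h | h
  · rw [min_eq_left h, max_eq_right h]
    constructor
    · exact fun h => Or.inl h
    · rintro (h' | ⟨rfl, rfl⟩)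
      · exact h'
      · exact ⟨le_antisymm h he, le_antisymm he h⟩
  · rw [min_eq_right h, max_eq_left h]
    constructor
    · exact fun h => Or.inr ⟨h.2, h.1⟩
    · rintro (⟨rfl, rfl⟩ | h')
      · exact ⟨le_antisymm h he, le_antisymm he h⟩
      · exact ⟨h'.2, h'.1⟩

theorem pairMatrix_mul_self {n : ℕ} {e : Fin n × Fin n} (he : e.1 ≤ e.2) :
    pairMatrix e * pairMatrix e = diagonal fun k => if k = e.1 ∨ k = e.2 then 1 else 0 := by
  ext k l
  rw [Matrix.mul_apply, Matrix.diagonal_apply]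
  simp only [pairMatrix, Matrix.of_apply, ← ite_and, mul_ite, mul_one, mul_zero]
  -- In row k only the partner of k in the pair e contributes, and from it the only way back is to
  -- k. This also covers pairs on the diagonal.
  have hone : ∀ j, ((min j l, max j l) = e ∧ (min k j, max k j) = e) ↔
      (k = l ∧ (k = e.1 ∨ k = e.2) ∧ j = if k = e.1 then e.2 else e.1) := by
    intro j
    rw [min_max_eq_iff he, min_max_eq_iff he]
    constructor
    · rintro ⟨⟨rfl, rfl⟩ | ⟨rfl, rfl⟩, ⟨rfl, h⟩ | ⟨rfl, h⟩⟩ <;> simp_all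
    · rintro ⟨rfl, rfl | rfl, rfl⟩
      · simp
      · split_ifs with h <;> simp [h]
  simp_rw [hone]
  by_cases hkl : k = l
  · by_cases hk : k = e.1 ∨ k = e.2 <;> simp [← hkl, hk]
  · simp [hkl]

/-- The residues of a pair of indices modulo `m + 1`. -/
def pairColor (m : ℕ) {n : ℕ} (e : Fin n × Fin n) : Fin (m + 1) × Fin (m + 1) :=
  (Fin.ofNat (m + 1) e.1, Fin.ofNat (m + 1) e.2)

/-- Upper triangular index pairs with prescribed residues modulo `m + 1`. -/
abbrev ColorClass (m n : ℕ) (c : Fin (m + 1) × Fin (m + 1)) : Type :=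
  {e : Fin n × Fin n // e.1 ≤ e.2 ∧ pairColor m e = c}

/-- Either endpoint may equal k, and the other endpoint then determines the pair. -/
theorem card_incident_le {m n : ℕ} {c : Fin (m + 1) × Fin (m + 1)} (k : Fin n) :
    (Finset.univ.filter fun e : ColorClass m n c => k = e.1.1 ∨ k = e.1.2).card ≤ 2 * n := by
  rw [Finset.filter_or, two_mul]
  refine (Finset.card_union_le _ _).trans (add_le_add ?_ ?_)
  · refine (Finset.card_le_card_of_injOn (t := Finset.univ) (fun e => e.1.2) (by simp) ?_).trans
      (by simp)
    intro e he e' he' h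
    simp only [Finset.coe_filter, Finset.mem_univ, true_and, Set.mem_ofPred_eq] at he he'
    exact Subtype.ext (Prod.ext (he.symm.trans he') h)
  · refine (Finset.card_le_card_of_injOn (t := Finset.univ) (fun e => e.1.1) (by simp) ?_).trans
      (by simp)
    intro e he e' he' h
    simp only [Finset.coe_filter, Finset.mem_univ, true_and, Set.mem_ofPred_eq] at he he'
    exact Subtype.ext (Prod.ext h (he.symm.trans he'))

theorem sum_smul_pairMatrix_apply {m n : ℕ} {c : Fin (m + 1) × Fin (m + 1)}
    (y : Fin n × Fin n → ℝ) (k l : Fin n) :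
    (∑ e : ColorClass m n c, y e.1 • pairMatrix e.1) k l =
      if pairColor m (min k l, max k l) = c then y (min k l, max k l) else 0 := by
  rw [Matrix.sum_apply]
  simp only [Matrix.smul_apply, pairMatrix, Matrix.of_apply, smul_eq_mul, mul_ite, mul_one,
    mul_zero]
  split_ifs with h
  · rw [Finset.sum_eq_single ⟨(min k l, max k l), min_le_max, h⟩]
    · simp
    · intro e _ he
      rw [if_neg]
      rintro h'
      exact he (Subtype.ext h'.symm)
    · simp
  · refine Finset.sum_eq_zero fun e _ => ?_
    rw [if_neg]
    intro h'
    exact h (h' ▸ e.2.2)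

theorem sum_pow_le_card_pow_mul {J : Type*} [Fintype J] {a : J → ℝ} (ha : ∀ j, 0 ≤ a j) {k : ℕ}
    (hk : k ≠ 0) : (∑ j, a j) ^ k ≤ (Fintype.card J : ℝ) ^ k * ∑ j, a j ^ k := by
  rcases isEmpty_or_nonempty J with h | h
  · simp [hk]
  obtain ⟨j, -, hj⟩ := Finset.exists_max_image Finset.univ a Finset.univ_nonempty
  calc (∑ j, a j) ^ k ≤ (Fintype.card J * a j) ^ k := by
        refine pow_le_pow_left₀ (Finset.sum_nonneg fun j _ => ha j) ?_ k
        refine (Finset.sum_le_sum fun i hi => hj i hi).trans ?_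
        simp
    _ = (Fintype.card J : ℝ) ^ k * a j ^ k := mul_pow _ _ _
    _ ≤ _ := by
        gcongr
        exact Finset.single_le_sum (f := fun j => a j ^ k) (fun i _ => pow_nonneg (ha i) k)
          (Finset.mem_univ j)

end MatrixDecomposition

/-! ### From m-dependence to moments of the norm of the whole matrix. -/

section Fields

open scoped Matrix.Norms.L2Operator

variable {Ω : Type*}

/-- The `n × n` matrix obtained by applying `f` to the entries of the symmetrized field. -/
noncomputable def symmMatrix (f : ℝ → ℝ) (X : ℕ → ℕ → Ω → ℝ) (n : ℕ) (ω : Ω) :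
    Matrix (Fin n) (Fin n) ℝ :=
  Matrix.of fun i j => f (symmField X i j ω)

theorem symmMatrix_isSymm (f : ℝ → ℝ) (X : ℕ → ℕ → Ω → ℝ) (n : ℕ) (ω : Ω) :
    (symmMatrix f X n ω).IsSymm := by
  ext i j
  simp only [symmMatrix, symmField, Matrix.transpose_apply, Matrix.of_apply, min_comm, max_comm]

theorem symmMatrix_eq_sum (m : ℕ) (f : ℝ → ℝ) (X : ℕ → ℕ → Ω → ℝ) (n : ℕ) (ω : Ω) :
    symmMatrix f X n ω =
      ∑ c, ∑ e : ColorClass m n c, f (symmField X e.1.1 e.1.2 ω) • pairMatrix e.1 := by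
  ext k l
  rw [Matrix.sum_apply, Finset.sum_congr rfl fun c _ => sum_smul_pairMatrix_apply
    (fun e : Fin n × Fin n => f (symmField X e.1 e.2 ω)) k l]
  simp [symmMatrix, symmField]

theorem norm_symmMatrix_le {f : ℝ → ℝ} {K : ℝ} (hK : 0 ≤ K) (hf : ∀ x, |f x| ≤ K)
    (X : ℕ → ℕ → Ω → ℝ) (n : ℕ) (ω : Ω) : ‖symmMatrix f X n ω‖ ≤ n * K := by
  have := (symmMatrix_isSymm f X n ω).norm_le_card_mul hK fun i j => hf _
  simpa using this

variable [MeasurableSpace Ω] {μ : Measure Ω}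

/-- The definition only separates two blocks; splitting off one position at a time upgrades this to
joint independence. -/
theorem IsMDependentOn.iIndepFun {m : ℕ} {S : Set (ℕ × ℕ)} {X : ℕ → ℕ → Ω → ℝ}
    [IsProbabilityMeasure μ] (h : IsMDependentOn m S X μ) {J : Type*} {p : J → ℕ × ℕ}
    (hp : ∀ j, p j ∈ S) (hd : ∀ i j, i ≠ j →
      (m : ℤ) < max |((p i).1 : ℤ) - ((p j).1 : ℤ)| |((p i).2 : ℤ) - ((p j).2 : ℤ)|) :
    iIndepFun (fun j => X (p j).1 (p j).2) μ := by
  classical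
  rw [iIndepFun_iff_measure_inter_preimage_eq_mul]
  intro T sets
  induction T using Finset.induction_on with
  | empty => intro _; simp
  | insert a T ha ih =>
    intro hs
    rw [Finset.prod_insert ha, ← ih fun i hi => hs i (Finset.mem_insert_of_mem hi)]
    have hind := h {p a} (p '' T) (by simpa using hp a)
      (by rintro _ ⟨j, -, rfl⟩; exact hp j) (by
        rintro _ rfl _ ⟨j, hj, rfl⟩
        exact hd a j (by rintro rfl; exact ha hj))
    have hj : ∀ j : T, p j ∈ p '' (T : Set J) := fun j => ⟨j, j.2, rfl⟩
    have key := hind.measure_inter_preimage_eq_mul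
      {u | u ⟨p a, rfl⟩ ∈ sets a} (⋂ j : T, {u | u ⟨p j, hj j⟩ ∈ sets j})
      ((measurable_pi_apply _) (hs a (Finset.mem_insert_self _ _)))
      (MeasurableSet.iInter fun j =>
        (measurable_pi_apply _) (hs j (Finset.mem_insert_of_mem j.2)))
    convert key using 2
    · ext ω
      simp
    · rfl
    · congr 1
      ext ω
      simp

theorem measurable_comp_symmMatrix {f : ℝ → ℝ} (hf : Measurable f) {X : ℕ → ℕ → Ω → ℝ}
    (hX : ∀ i j, Measurable (X i j)) {n : ℕ} {G : Matrix (Fin n) (Fin n) ℝ → ℝ}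
    (hG : Continuous G) : Measurable fun ω => G (symmMatrix f X n ω) := by
  have h1 : Continuous fun u : Fin n → Fin n → ℝ => G (Matrix.of u) := hG.comp continuous_id
  exact h1.measurable.comp (measurable_pi_lambda _ fun i => measurable_pi_lambda _ fun j =>
    hf.comp (hX _ _))

theorem IsStationaryField.identDistrib {X : ℕ → ℕ → Ω → ℝ} (h : IsStationaryField X μ)
    (i j : ℕ) : IdentDistrib (X i j) (X 0 0) μ μ := by
  have := (h i j).comp (measurable_pi_apply ((0, 0) : ℕ × ℕ))
  simpa [Function.comp_def] using this

/-- Integers congruent modulo m + 1 and at distance at most m coincide, so distinct positions of one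
class are far enough apart for m-dependence to apply. -/
theorem iIndepFun_colorClass [IsProbabilityMeasure μ] {m : ℕ} {X : ℕ → ℕ → Ω → ℝ}
    (h : IsMDependentOn m {p : ℕ × ℕ | p.1 ≤ p.2} (symmField X) μ) (n : ℕ)
    (c : Fin (m + 1) × Fin (m + 1)) :
    iIndepFun (fun e : ColorClass m n c => symmField X e.1.1 e.1.2) μ := by
  refine h.iIndepFun (p := fun e : ColorClass m n c => ((e.1.1 : ℕ), (e.1.2 : ℕ)))
    (fun e => e.2.1) ?_
  intro e e' hne
  by_contra! hlt
  refine hne (Subtype.ext ?_)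
  have hc : pairColor m e.1 = pairColor m e'.1 := e.2.2.trans e'.2.2.symm
  simp only [pairColor, Prod.mk.injEq, Fin.ofNat, Fin.mk.injEq] at hc
  have aux : ∀ a b : ℕ, a % (m + 1) = b % (m + 1) → |(a : ℤ) - b| ≤ m → a = b := by
    intro a b hab habs
    have h1 : ((m + 1 : ℕ) : ℤ) ∣ (b : ℤ) - a := Nat.modEq_iff_dvd.1 hab
    have h2 : (b : ℤ) - a = 0 := Int.eq_zero_of_abs_lt_dvd h1 (by
      rw [abs_sub_comm] at habs; push_cast; omega)
    omega
  exact Prod.ext (Fin.ext (aux _ _ hc.1 ((le_max_left _ _).trans hlt)))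
    (Fin.ext (aux _ _ hc.2 ((le_max_right _ _).trans hlt)))

theorem integral_norm_colorClass_pow_le [IsProbabilityMeasure μ] {m : ℕ} {X : ℕ → ℕ → Ω → ℝ}
    (hX : ∀ i j, Measurable (X i j)) (hst : IsStationaryField X μ)
    (hm : IsMDependentOn m {p : ℕ × ℕ | p.1 ≤ p.2} (symmField X) μ) {f : ℝ → ℝ}
    (hf : Measurable f) {K Λ b : ℝ} (hfK : ∀ x, |f x| ≤ K) (hΛ : 0 < Λ) (hKΛ : K ^ 2 ≤ Λ) {n : ℕ}
    (hv : n * ∫ ω, f (X 0 0 ω) ^ 2 ∂μ ≤ Λ) (hb : |∫ ω, f (X 0 0 ω) ∂μ| ≤ b)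
    (c : Fin (m + 1) × Fin (m + 1)) {s : ℕ} (hs : s ≠ 0) :
    ∫ ω, ‖∑ e : ColorClass m n c, f (symmField X e.1.1 e.1.2 ω) • pairMatrix e.1‖ ^ (2 * s) ∂μ ≤
      2 ^ (2 * s) * ((n * b) ^ (2 * s) + Real.exp 4 * n ^ 2 * (16 * s ^ 2 * Λ) ^ s) := by
  have hK : 0 ≤ K := (abs_nonneg _).trans (hfK 0)
  have hfX : ∀ i j, Measurable fun ω => f (symmField X i j ω) := fun i j => hf.comp (hX _ _)
  set ν : Measure ℝ := μ.map fun ω => f (X 0 0 ω) with hν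
  have hfX0 : AEMeasurable (fun ω => f (X 0 0 ω)) μ := (hf.comp (hX 0 0)).aemeasurable
  have hνp : IsProbabilityMeasure ν := Measure.isProbabilityMeasure_map hfX0
  have hνK : ∀ᵐ x ∂ν, |x| ≤ K := by
    rw [hν, ae_map_iff hfX0 (measurableSet_le (by fun_prop) (by fun_prop))]
    exact ae_of_all _ fun ω => hfK _
  have hlaw : μ.map (fun ω (e : ColorClass m n c) => f (symmField X e.1.1 e.1.2 ω)) =
      Measure.pi fun _ : ColorClass m n c => ν := by
    have h1 := (iIndepFun_colorClass hm n c).comp (fun _ => f) fun _ => hf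
    refine ((iIndepFun_iff_map_fun_eq_pi_map
      (f := fun (e : ColorClass m n c) ω => f (symmField X e.1.1 e.1.2 ω))
      fun e => (hfX _ _).aemeasurable).1 h1).trans ?_
    congr 1
    funext e
    exact ((hst.identDistrib _ _).comp hf).map_eq
  have h1 : ∫ ω, ‖∑ e : ColorClass m n c, f (symmField X e.1.1 e.1.2 ω) • pairMatrix e.1‖ ^
      (2 * s) ∂μ = ∫ y, ‖∑ e : ColorClass m n c, y e • pairMatrix e.1‖ ^ (2 * s)
        ∂Measure.pi fun _ : ColorClass m n c => ν := by
    rw [← hlaw, integral_map (measurable_pi_lambda _ fun e => hfX _ _).aemeasurable]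
    exact Continuous.aestronglyMeasurable (by fun_prop)
  rw [h1]
  refine (integral_norm_pow_le_symmetrized hK (fun _ => hνK)
    (fun e : ColorClass m n c => pairMatrix e.1) (2 * s)).trans ?_
  have hb0 : 0 ≤ b := (abs_nonneg _).trans hb
  have hmean : ∫ x, x ∂ν = ∫ ω, f (X 0 0 ω) ∂μ :=
    integral_map hfX0 aestronglyMeasurable_id
  have hsq : ∫ x, x ^ 2 ∂ν = ∫ ω, f (X 0 0 ω) ^ 2 ∂μ :=
    integral_map hfX0 (by fun_prop)
  gcongr
  · have hsymm : (∑ e : ColorClass m n c, (∫ x, x ∂ν) • pairMatrix e.1).IsSymm := by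
      rw [Matrix.IsSymm, Matrix.transpose_sum]
      exact Finset.sum_congr rfl fun e _ => by
        rw [Matrix.transpose_smul, (pairMatrix_isSymm _).eq]
    have := hsymm.norm_le_card_mul hb0 fun i j => by
      rw [sum_smul_pairMatrix_apply (fun _ => ∫ x, x ∂ν)]
      split_ifs
      · rw [hmean]; exact hb
      · simpa using hb0
    simpa using this
  -- Symmetrization doubles the bound on the entries and at most quadruples their second moment,
  -- hence 2K and 4Λ.
  · have := integral_norm_pow_le_of_symmetric (ρ := fun _ : ColorClass m n c => symmetrizedLaw ν)
      (fun _ => symmetrizedLaw_map_neg ν) (K := 2 * K) (Λ := 4 * Λ) (by positivity)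
      (by positivity) (by nlinarith) (fun _ => symmetrizedLaw_ae_le hνK)
      (fun _ => by
        have h2 := symmetrizedLaw_integral_sq_le hνK
        rw [hsq] at h2
        have : (n : ℝ) * ∫ x, x ^ 2 ∂symmetrizedLaw ν ≤
          n * (4 * ∫ ω, f (X 0 0 ω) ^ 2 ∂μ) := by gcongr
        linarith)
      (B := fun e => pairMatrix e.1) (fun e => pairMatrix_isSymm _)
      (inc := fun k => Finset.univ.filter fun e => k = e.1.1 ∨ k = e.1.2)
      card_incident_le (fun e => by simpa using pairMatrix_mul_self e.2.1) hs
    refine this.trans_eq ?_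
    rw [show 4 * (s : ℝ) ^ 2 * (4 * Λ) = 16 * s ^ 2 * Λ by ring]

/-- Moment bound for the norm of a symmetric matrix with `m`-dependent bounded entries. -/
theorem integral_norm_symmMatrix_pow_le [IsProbabilityMeasure μ] {m : ℕ} {X : ℕ → ℕ → Ω → ℝ}
    (hX : ∀ i j, Measurable (X i j)) (hst : IsStationaryField X μ)
    (hm : IsMDependentOn m {p : ℕ × ℕ | p.1 ≤ p.2} (symmField X) μ) {f : ℝ → ℝ}
    (hf : Measurable f) {K Λ b : ℝ} (hfK : ∀ x, |f x| ≤ K) (hΛ : 0 < Λ) (hKΛ : K ^ 2 ≤ Λ) {n : ℕ}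
    (hv : n * ∫ ω, f (X 0 0 ω) ^ 2 ∂μ ≤ Λ) (hb : |∫ ω, f (X 0 0 ω) ∂μ| ≤ b)
    {s : ℕ} (hs : s ≠ 0) :
    ∫ ω, ‖symmMatrix f X n ω‖ ^ (2 * s) ∂μ ≤ (m + 1) ^ 2 * (2 * (m + 1) ^ 2) ^ (2 * s) *
      ((n * b) ^ (2 * s) + Real.exp 4 * n ^ 2 * (16 * s ^ 2 * Λ) ^ s) := by
  have hK : 0 ≤ K := (abs_nonneg _).trans (hfK 0)
  have hpt : ∀ ω, ‖symmMatrix f X n ω‖ ^ (2 * s) ≤ ((m + 1 : ℝ) ^ 2) ^ (2 * s) *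
      ∑ c, ‖∑ e : ColorClass m n c, f (symmField X e.1.1 e.1.2 ω) • pairMatrix e.1‖ ^ (2 * s) := by
    intro ω
    rw [symmMatrix_eq_sum m]
    refine (pow_le_pow_left₀ (norm_nonneg _) (norm_sum_le _ _) _).trans ?_
    refine (sum_pow_le_card_pow_mul (fun c => norm_nonneg _) (by omega)).trans_eq ?_
    simp [pow_two]
  have hint : ∀ c, Integrable (fun ω => ‖∑ e : ColorClass m n c,
      f (symmField X e.1.1 e.1.2 ω) • pairMatrix e.1‖ ^ (2 * s)) μ := by
    intro c
    have hmeas : Measurable fun ω (e : ColorClass m n c) => f (symmField X e.1.1 e.1.2 ω) :=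
      measurable_pi_lambda _ fun e => hf.comp (hX _ _)
    have hcont : Continuous fun y : ColorClass m n c → ℝ =>
      ‖∑ e : ColorClass m n c, y e • pairMatrix e.1‖ ^ (2 * s) := by fun_prop
    refine (integrable_map_measure hcont.aestronglyMeasurable hmeas.aemeasurable).1
      (integrable_of_continuous_of_ae_norm_le hcont (K := K) ?_)
    rw [ae_map_iff hmeas.aemeasurable (measurableSet_le (by fun_prop) (by fun_prop))]
    exact ae_of_all _ fun ω => (pi_norm_le_iff_of_nonneg hK).2 fun e => hfK _
  have hint0 : Integrable (fun ω => ‖symmMatrix f X n ω‖ ^ (2 * s)) μ := by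
    refine Integrable.of_bound (measurable_comp_symmMatrix hf hX
      (G := fun A => ‖A‖ ^ (2 * s)) (by fun_prop)).aestronglyMeasurable ((n * K) ^ (2 * s)) ?_
    refine ae_of_all _ fun ω => ?_
    rw [norm_pow, norm_norm]
    exact pow_le_pow_left₀ (norm_nonneg _) (norm_symmMatrix_le hK hfK X n ω) _
  calc ∫ ω, ‖symmMatrix f X n ω‖ ^ (2 * s) ∂μ
      ≤ ∫ ω, ((m + 1 : ℝ) ^ 2) ^ (2 * s) * ∑ c, ‖∑ e : ColorClass m n c,
          f (symmField X e.1.1 e.1.2 ω) • pairMatrix e.1‖ ^ (2 * s) ∂μ :=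
        integral_mono hint0 ((integrable_finsetSum _ fun c _ => hint c).const_mul _) hpt
    _ = ((m + 1 : ℝ) ^ 2) ^ (2 * s) * ∑ c, ∫ ω, ‖∑ e : ColorClass m n c,
          f (symmField X e.1.1 e.1.2 ω) • pairMatrix e.1‖ ^ (2 * s) ∂μ := by
        rw [integral_const_mul, integral_finsetSum _ fun c _ => hint c]
    _ ≤ ((m + 1 : ℝ) ^ 2) ^ (2 * s) * ∑ _c : Fin (m + 1) × Fin (m + 1), 2 ^ (2 * s) *
          ((n * b) ^ (2 * s) + Real.exp 4 * n ^ 2 * (16 * s ^ 2 * Λ) ^ s) := by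
        gcongr with c _
        exact integral_norm_colorClass_pow_le hX hst hm hf hfK hΛ hKΛ hv hb c hs
    _ = _ := by
        rw [Finset.sum_const, Finset.card_univ, nsmul_eq_mul, mul_pow 2]
        simp only [Fintype.card_prod, Fintype.card_fin]
        push_cast
        ring

end Fields

/-! ### Potter bounds, moments, the normalising sequence, and slowly varying sequences. -/

section RegularVariation

theorem tendsto_two_mul_div_of_regVarying {T L : ℝ → ℝ} {α : ℝ} (hL : IsSlowlyVarying L)
    (hT : ∀ x, 0 < x → T x = x ^ (-α) * L x) :
    Tendsto (fun x => T (2 * x) / T x) atTop (𝓝 (2 ^ (-α))) := by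
  have h := (hL.2 2 two_pos).const_mul ((2 : ℝ) ^ (-α))
  rw [mul_one] at h
  refine h.congr' ?_
  filter_upwards [eventually_gt_atTop 0, hL.1] with x hx hLx
  have hxa : 0 < x ^ (-α) := Real.rpow_pos_of_pos hx _
  rw [hT x hx, hT (2 * x) (by positivity), Real.mul_rpow two_pos.le hx.le]
  field_simp

theorem eventually_pos_of_regVarying {T L : ℝ → ℝ} {α : ℝ} (hL : IsSlowlyVarying L)
    (hT : ∀ x, 0 < x → T x = x ^ (-α) * L x) : ∀ᶠ x in atTop, 0 < T x := by
  filter_upwards [eventually_gt_atTop 0, hL.1] with x hx hLx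
  rw [hT x hx]
  positivity

theorem exists_dyadic {x₀ x : ℝ} (h0 : 0 < x₀) (hx : x₀ ≤ x) :
    ∃ k : ℕ, 2 ^ k * x₀ ≤ x ∧ x ≤ 2 ^ (k + 1) * x₀ := by
  obtain ⟨k, hk1, hk2⟩ := exists_nat_pow_near ((one_le_div h0).2 hx) one_lt_two
  exact ⟨k, (le_div_iff₀ h0).1 hk1, ((div_lt_iff₀ h0).1 hk2).le⟩

/-- Upper Potter bound. -/
theorem exists_le_rpow_of_regVarying {T L : ℝ → ℝ} {α p : ℝ} (hL : IsSlowlyVarying L)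
    (hT : ∀ x, 0 < x → T x = x ^ (-α) * L x) (hanti : Antitone T) (hp0 : 0 < p) (hp : p < α) :
    ∃ x₀ C : ℝ, 1 ≤ x₀ ∧ 0 < C ∧ ∀ x, x₀ ≤ x → T x ≤ C * x ^ (-p) := by
  have h1 : ∀ᶠ x in atTop, T (2 * x) / T x < 2 ^ (-p) :=
    (tendsto_two_mul_div_of_regVarying hL hT).eventually_lt_const
      (Real.rpow_lt_rpow_of_exponent_lt one_lt_two (by linarith))
  obtain ⟨x₁, hx₁⟩ := eventually_atTop.1 (h1.and (eventually_pos_of_regVarying hL hT))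
  set x₀ := max x₁ 1 with hx₀
  have hx₀1 : 1 ≤ x₀ := le_max_right _ _
  have hx₀0 : 0 < x₀ := by linarith
  -- The doubling ratio tends to 2^(-α) < 2^(-p), so the bound propagates along dyadic points;
  -- monotonicity of T fills the gaps at the cost of a constant.
  have hstep : ∀ k : ℕ, T (2 ^ k * x₀) ≤ ((2 : ℝ) ^ (-p)) ^ k * T x₀ := by
    intro k
    induction k with
    | zero => simp
    | succ k ih =>
      have hk : x₁ ≤ 2 ^ k * x₀ := by
        have : (1 : ℝ) ≤ 2 ^ k := one_le_pow₀ one_le_two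
        calc x₁ ≤ x₀ := le_max_left _ _
          _ ≤ 2 ^ k * x₀ := le_mul_of_one_le_left hx₀0.le this
      obtain ⟨ha, hb⟩ := hx₁ _ hk
      rw [div_lt_iff₀ hb] at ha
      rw [pow_succ', mul_assoc, pow_succ', mul_assoc]
      exact ha.le.trans (by gcongr)
  have hTx₀ : 0 < T x₀ := (hx₁ x₀ (le_max_left _ _)).2
  refine ⟨x₀, 2 ^ p * x₀ ^ p * T x₀, hx₀1, by positivity, fun x hx => ?_⟩
  have hx0 : 0 < x := by linarith
  obtain ⟨k, hk1, hk2⟩ := exists_dyadic hx₀0 hx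
  refine (hanti hk1).trans ((hstep k).trans ?_)
  have h3 : (2 : ℝ) ^ (-p) * (((2 : ℝ) ^ (-p)) ^ k * x₀ ^ (-p)) ≤ x ^ (-p) := by
    rw [← mul_assoc, ← pow_succ', ← Real.rpow_mul_natCast two_pos.le, mul_comm (-p),
      Real.rpow_mul two_pos.le, Real.rpow_natCast, ← Real.mul_rpow (by positivity) hx₀0.le]
    exact Real.rpow_le_rpow_of_nonpos hx0 hk2 (by linarith)
  calc ((2 : ℝ) ^ (-p)) ^ k * T x₀ = 2 ^ p * x₀ ^ p * T x₀ *
        ((2 : ℝ) ^ (-p) * (((2 : ℝ) ^ (-p)) ^ k * x₀ ^ (-p))) := by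
        rw [Real.rpow_neg two_pos.le, Real.rpow_neg hx₀0.le]
        have := Real.rpow_pos_of_pos hx₀0 p
        field_simp
    _ ≤ _ := by gcongr

/-- Lower Potter bound. -/
theorem exists_rpow_le_of_regVarying {T L : ℝ → ℝ} {α p : ℝ} (hL : IsSlowlyVarying L)
    (hT : ∀ x, 0 < x → T x = x ^ (-α) * L x) (hanti : Antitone T) (hp0 : 0 < p) (hp : α < p) :
    ∃ x₀ c : ℝ, 1 ≤ x₀ ∧ 0 < c ∧ ∀ x, x₀ ≤ x → c * x ^ (-p) ≤ T x := by
  have h1 : ∀ᶠ x in atTop, 2 ^ (-p) < T (2 * x) / T x :=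
    (tendsto_two_mul_div_of_regVarying hL hT).eventually_const_lt
      (Real.rpow_lt_rpow_of_exponent_lt one_lt_two (by linarith))
  obtain ⟨x₁, hx₁⟩ := eventually_atTop.1 (h1.and (eventually_pos_of_regVarying hL hT))
  set x₀ := max x₁ 1 with hx₀
  have hx₀1 : 1 ≤ x₀ := le_max_right _ _
  have hx₀0 : 0 < x₀ := by linarith
  have hstep : ∀ k : ℕ, ((2 : ℝ) ^ (-p)) ^ k * T x₀ ≤ T (2 ^ k * x₀) := by
    intro k
    induction k with
    | zero => simp
    | succ k ih =>
      have hk : x₁ ≤ 2 ^ k * x₀ := by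
        have : (1 : ℝ) ≤ 2 ^ k := one_le_pow₀ one_le_two
        calc x₁ ≤ x₀ := le_max_left _ _
          _ ≤ 2 ^ k * x₀ := le_mul_of_one_le_left hx₀0.le this
      obtain ⟨ha, hb⟩ := hx₁ _ hk
      rw [lt_div_iff₀ hb] at ha
      rw [pow_succ', mul_assoc, pow_succ', mul_assoc]
      exact le_trans (by gcongr) ha.le
  have hTx₀ : 0 < T x₀ := (hx₁ x₀ (le_max_left _ _)).2
  refine ⟨x₀, 2 ^ (-p) * x₀ ^ p * T x₀, hx₀1, by positivity, fun x hx => ?_⟩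
  have hx0 : 0 < x := by linarith
  obtain ⟨k, hk1, hk2⟩ := exists_dyadic hx₀0 hx
  refine le_trans ?_ ((hstep (k + 1)).trans (hanti hk2))
  have h3 : x ^ (-p) ≤ ((2 : ℝ) ^ (-p)) ^ k * x₀ ^ (-p) := by
    rw [← Real.rpow_mul_natCast two_pos.le, mul_comm (-p),
      Real.rpow_mul two_pos.le, Real.rpow_natCast, ← Real.mul_rpow (by positivity) hx₀0.le]
    exact Real.rpow_le_rpow_of_nonpos (by positivity) hk1 (by linarith)
  calc 2 ^ (-p) * x₀ ^ p * T x₀ * x ^ (-p)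
      ≤ 2 ^ (-p) * x₀ ^ p * T x₀ * (((2 : ℝ) ^ (-p)) ^ k * x₀ ^ (-p)) := by gcongr
    _ = _ := by
        rw [pow_succ, Real.rpow_neg hx₀0.le]
        have := Real.rpow_pos_of_pos hx₀0 p
        field_simp

variable {Ω : Type*} [MeasurableSpace Ω] {μ : Measure Ω}

theorem antitone_measureReal_lt_abs [IsFiniteMeasure μ] (Y : Ω → ℝ) :
    Antitone fun x => μ.real {ω | x < |Y ω|} :=
  fun _ _ hab => measureReal_mono fun _ hω => lt_of_le_of_lt hab hω

/-- Layer cake formula, with the tail bounded by a power whose exponent is midway between q and α.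
-/
theorem HasRegVaryingTail.integrable_rpow [IsProbabilityMeasure μ] {Y : Ω → ℝ} {α q : ℝ}
    (hY : Measurable Y) (h : HasRegVaryingTail Y α μ) (hq0 : 0 < q) (hq : q < α) :
    Integrable (fun ω => |Y ω| ^ q) μ := by
  obtain ⟨L, hL, hT⟩ := h
  obtain ⟨x₀, C, hx₀, hC, hb⟩ := exists_le_rpow_of_regVarying (p := (q + α) / 2) hL hT
    (antitone_measureReal_lt_abs Y) (by linarith) (by linarith)
  rw [← lintegral_ofReal_ne_top_iff_integrable
      (hY.abs.pow_const q).aestronglyMeasurable (ae_of_all _ fun ω => by positivity),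
    lintegral_rpow_eq_lintegral_meas_lt_mul μ (ae_of_all _ fun ω => abs_nonneg _) (by fun_prop) hq0]
  refine ENNReal.mul_ne_top ENNReal.ofReal_ne_top (ne_of_lt ?_)
  rw [← Set.Ioc_union_Ioi_eq_Ioi (zero_le_one.trans hx₀)]
  refine (lintegral_union_le _ _ _).trans_lt (ENNReal.add_lt_top.2 ⟨?_, ?_⟩)
  · have hi : IntegrableOn (fun t : ℝ => t ^ (q - 1)) (Set.Ioc 0 x₀) :=
      (intervalIntegrable_iff_integrableOn_Ioc_of_le (zero_le_one.trans hx₀)).1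
        (intervalIntegral.intervalIntegrable_rpow' (by linarith))
    refine lt_of_le_of_lt (setLIntegral_mono' measurableSet_Ioc fun t _ => ?_) hi.lintegral_lt_top
    exact mul_le_of_le_one_left' prob_le_one
  · have hi : IntegrableOn (fun t : ℝ => C * t ^ (-((q + α) / 2) + (q - 1))) (Set.Ioi x₀) :=
      (integrableOn_Ioi_rpow_of_lt (by linarith) (by linarith)).const_mul C
    refine lt_of_le_of_lt (setLIntegral_mono' measurableSet_Ioi fun t ht => ?_) hi.lintegral_lt_top
    have ht0 : 0 < t := by linarith [Set.mem_Ioi.1 ht]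
    rw [Real.rpow_add ht0, ← mul_assoc, ENNReal.ofReal_mul (by positivity)]
    gcongr
    rw [← ENNReal.ofReal_toReal (measure_ne_top μ _)]
    exact ENNReal.ofReal_le_ofReal (hb t (Set.mem_Ioi.1 ht).le)

/-- The normalizing sequence grows faster than every power smaller than `1 / α`. -/
theorem HasRegVaryingTail.eventually_rpow_le [IsProbabilityMeasure μ] {Y : Ω → ℝ} {α τ : ℝ}
    (h : HasRegVaryingTail Y α μ) (hα : 0 < α) (hτ0 : 0 < τ) (hτ : τ < 1 / α) {a : ℕ → ℝ}
    (ha : Tendsto (fun n : ℕ => (n : ℝ) * μ.real {ω | a n < |Y ω|}) atTop (𝓝 1)) :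
    ∀ᶠ n : ℕ in atTop, (n : ℝ) ^ τ ≤ a n := by
  obtain ⟨L, hL, hT⟩ := h
  have hτα : α < 1 / τ := by rwa [lt_one_div hα hτ0]
  obtain ⟨p, hp1, hp2⟩ := exists_between hτα
  have hp0 : 0 < p := hα.trans hp1
  obtain ⟨x₀, c, hx₀, hc, hb⟩ := exists_rpow_le_of_regVarying (p := p) hL hT
    (antitone_measureReal_lt_abs Y) hp0 hp1
  have hτp : 0 < 1 - τ * p := by
    rw [lt_div_iff₀ hτ0] at hp2; linarith
  have h1 : Tendsto (fun n : ℕ => (n : ℝ) ^ τ) atTop atTop :=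
    (tendsto_rpow_atTop hτ0).comp tendsto_natCast_atTop_atTop
  have h2 : Tendsto (fun n : ℕ => c * (n : ℝ) ^ (1 - τ * p)) atTop atTop :=
    ((tendsto_rpow_atTop hτp).comp tendsto_natCast_atTop_atTop).const_mul_atTop hc
  filter_upwards [ha.eventually_lt_const one_lt_two, h1.eventually_ge_atTop x₀,
    h2.eventually_ge_atTop 2, eventually_gt_atTop 0] with n hn1 hn2 hn3 hn0
  by_contra! hlt
  have hn0' : (0 : ℝ) < n := by exact_mod_cast hn0
  -- If a n were below n^τ, then n times the tail at a n would be at least c n^(1 - τp), which is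
  -- unbounded because p < 1/τ; yet it tends to 1.
  have h4 := (hb _ hn2).trans (antitone_measureReal_lt_abs (μ := μ) Y hlt.le)
  have h5 : (n : ℝ) * (c * ((n : ℝ) ^ τ) ^ (-p)) = c * (n : ℝ) ^ (1 - τ * p) := by
    rw [← Real.rpow_mul hn0'.le, sub_eq_add_neg, Real.rpow_add hn0', Real.rpow_one, mul_neg]
    ring
  have h6 := mul_le_mul_of_nonneg_left h4 hn0'.le
  rw [h5] at h6
  linarith

/-- Halving n eventually costs at most a factor 2^δ, so strong induction descends to a finite
initial segment, whose sum serves as the constant. -/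
theorem IsSlowlyVaryingSeq.exists_le_rpow {s : ℕ → ℕ} (hs : IsSlowlyVaryingSeq s) {δ : ℝ}
    (hδ : 0 < δ) : ∃ A : ℝ, 0 ≤ A ∧ ∀ n : ℕ, 1 ≤ n → (s n : ℝ) ≤ A * (n : ℝ) ^ δ := by
  have h1 : (2 : ℝ) ^ (-δ) < 1 := Real.rpow_lt_one_of_one_lt_of_neg one_lt_two (by linarith)
  obtain ⟨N₀, hN₀⟩ := eventually_atTop.1 ((hs (1 / 2) (by norm_num)).eventually_const_lt h1)
  set N := max N₀ 2 with hN
  set A : ℝ := ∑ k ∈ Finset.range N, (s k : ℝ) with hA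
  have hA0 : 0 ≤ A := Finset.sum_nonneg fun _ _ => Nat.cast_nonneg _
  refine ⟨A, hA0, fun n => ?_⟩
  induction n using Nat.strong_induction_on with
  | _ n ih =>
    intro hn
    have hn1 : (1 : ℝ) ≤ n := by exact_mod_cast hn
    rcases lt_or_ge n N with hlt | hge
    · calc (s n : ℝ) ≤ A := Finset.single_le_sum (f := fun k => (s k : ℝ))
            (fun _ _ => Nat.cast_nonneg _) (Finset.mem_range.2 hlt)
        _ ≤ A * (n : ℝ) ^ δ := le_mul_of_one_le_right hA0 (Real.one_le_rpow hn1 hδ.le)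
    · have hn2 : 2 ≤ n := (le_max_right _ _).trans hge
      have h2 := hN₀ n ((le_max_left _ _).trans hge)
      set k := ⌊(1 / 2 : ℝ) * n⌋₊ with hk
      have hkle : (k : ℝ) ≤ 1 / 2 * n := Nat.floor_le (by positivity)
      have hk1 : 1 ≤ k := by
        rw [hk, Nat.one_le_floor_iff]
        have : (2 : ℝ) ≤ n := by exact_mod_cast hn2
        linarith
      have hkn : k < n := by
        have : (k : ℝ) < n := by linarith
        exact_mod_cast this
      -- A zero value would make the quotient 0 by the convention for division, contradicting its
      -- positive lower bound.
      have hsn : (0 : ℝ) < s n := by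
        rcases Nat.eq_zero_or_pos (s n) with h0 | h0
        · rw [h0, Nat.cast_zero, div_zero] at h2
          exact absurd h2 (not_lt.2 (by positivity))
        · exact_mod_cast h0
      rw [lt_div_iff₀ hsn, Real.rpow_neg two_pos.le, inv_mul_lt_iff₀ (by positivity)] at h2
      calc (s n : ℝ) ≤ 2 ^ δ * s k := h2.le
        _ ≤ 2 ^ δ * (A * (k : ℝ) ^ δ) := by gcongr; exact ih k hkn hk1
        _ ≤ 2 ^ δ * (A * (1 / 2 * n : ℝ) ^ δ) := by gcongr
        _ = A * ((2 : ℝ) * (1 / 2 * n)) ^ δ := by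
            rw [Real.mul_rpow two_pos.le (by positivity)]; ring
        _ = _ := by congr 2; ring

theorem IsSlowlyVaryingSeq.eventually_const_mul_le_rpow {s : ℕ → ℕ} (hs : IsSlowlyVaryingSeq s)
    {δ : ℝ} (hδ : 0 < δ) {D : ℝ} (hD : 0 ≤ D) : ∀ᶠ n : ℕ in atTop, D * s n ≤ (n : ℝ) ^ δ := by
  obtain ⟨A, hA, h⟩ := hs.exists_le_rpow (half_pos hδ)
  have h1 : Tendsto (fun n : ℕ => (n : ℝ) ^ (δ / 2)) atTop atTop :=
    (tendsto_rpow_atTop (half_pos hδ)).comp tendsto_natCast_atTop_atTop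
  filter_upwards [h1.eventually_ge_atTop (D * A), eventually_ge_atTop 1] with n hn hn1
  have hn0 : (0 : ℝ) < n := by exact_mod_cast hn1
  calc D * s n ≤ D * (A * (n : ℝ) ^ (δ / 2)) := by gcongr; exact h n hn1
    _ = D * A * (n : ℝ) ^ (δ / 2) := by ring
    _ ≤ (n : ℝ) ^ (δ / 2) * (n : ℝ) ^ (δ / 2) := by gcongr
    _ = _ := by rw [← Real.rpow_add hn0, add_halves]

end RegularVariation

/-! ### Truncation of a heavy-tailed variable: second moment and mean. -/

section Truncation

/-- `f` truncates its argument at level `K` (the value at `±K` is not specified). -/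
structure IsTruncation (f : ℝ → ℝ) (K : ℝ) : Prop where
  measurable : Measurable f
  eq_or_eq : ∀ x, f x = x ∨ f x = 0
  eq_of_lt : ∀ x, |x| < K → f x = x
  abs_le : ∀ x, |f x| ≤ K

/-- The strict cut-off occurs in `smallMatrix`, the non-strict one in `truncBelow`; the abstract
notion treats both at once. -/
theorem isTruncation_lt {K : ℝ} (hK : 0 ≤ K) :
    IsTruncation (fun x => if |x| < K then x else 0) K where
  measurable := Measurable.ite (measurableSet_lt (by fun_prop) (by fun_prop)) (by fun_prop)
    (by fun_prop)
  eq_or_eq x := by split_ifs <;> simp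
  eq_of_lt x hx := if_pos hx
  abs_le x := by
    split_ifs with h
    · exact h.le
    · simpa using hK

theorem isTruncation_le {K : ℝ} (hK : 0 ≤ K) :
    IsTruncation (fun x => if |x| ≤ K then x else 0) K where
  measurable := Measurable.ite (measurableSet_le (by fun_prop) (by fun_prop)) (by fun_prop)
    (by fun_prop)
  eq_or_eq x := by split_ifs <;> simp
  eq_of_lt x hx := if_pos hx.le
  abs_le x := by
    split_ifs with h
    · exact h
    · simpa using hK

variable {f : ℝ → ℝ} {K : ℝ}

theorem IsTruncation.sq_le (hf : IsTruncation f K) {q : ℝ} (hq2 : q ≤ 2) (x : ℝ) :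
    f x ^ 2 ≤ K ^ (2 - q) * |x| ^ q := by
  have hK : 0 ≤ K := (abs_nonneg _).trans (hf.abs_le 0)
  rcases hf.eq_or_eq x with h | h
  · have hx := hf.abs_le x
    rw [h] at hx ⊢
    rcases eq_or_ne x 0 with rfl | h0
    · simp only [ne_eq, OfNat.ofNat_ne_zero, not_false_eq_true, zero_pow]; positivity
    have hx0 : 0 < |x| := abs_pos.2 h0
    calc x ^ 2 = |x| ^ (2 - q) * |x| ^ q := by
          rw [← Real.rpow_add hx0, sub_add_cancel, Real.rpow_two, sq_abs]
      _ ≤ _ := by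
          gcongr
  · rw [h]; simp only [ne_eq, OfNat.ofNat_ne_zero, not_false_eq_true, zero_pow]; positivity

theorem IsTruncation.abs_sub_le (hf : IsTruncation f K) (hK : 0 < K) {p : ℝ} (hp : 1 ≤ p) (x : ℝ) :
    |f x - x| ≤ K ^ (1 - p) * |x| ^ p := by
  rcases lt_or_ge |x| K with h | h
  · rw [hf.eq_of_lt x h, sub_self, abs_zero]; positivity
  have hx0 : 0 < |x| := hK.trans_le h
  calc |f x - x| ≤ |x| := by rcases hf.eq_or_eq x with h | h <;> simp [h]
    _ = |x| ^ (1 - p) * |x| ^ p := by rw [← Real.rpow_add hx0, sub_add_cancel, Real.rpow_one]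
    _ ≤ _ := by
        exact mul_le_mul_of_nonneg_right (Real.rpow_le_rpow_of_nonpos hK h (by linarith))
          (by positivity)

variable {Ω : Type*} [MeasurableSpace Ω] {μ : Measure Ω}

theorem IsTruncation.integral_sq_le [IsProbabilityMeasure μ] (hf : IsTruncation f K) {Y : Ω → ℝ}
    {q : ℝ} (hq2 : q ≤ 2) (hi : Integrable (fun ω => |Y ω| ^ q) μ) :
    ∫ ω, f (Y ω) ^ 2 ∂μ ≤ K ^ (2 - q) * ∫ ω, |Y ω| ^ q ∂μ := by
  rw [← integral_const_mul]
  refine integral_mono_of_nonneg (ae_of_all _ fun ω => sq_nonneg _) (hi.const_mul _)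
    (ae_of_all _ fun ω => hf.sq_le hq2 _)

/-- As Y is centred, the truncated mean equals the mean of the truncation error, which lives where
|Y| ≥ K and is small there by the p-th moment. -/
theorem IsTruncation.abs_integral_le [IsProbabilityMeasure μ] (hf : IsTruncation f K)
    (hK : 0 < K) {Y : Ω → ℝ} (hY : Measurable Y) (hYi : Integrable Y μ) (hY0 : ∫ ω, Y ω ∂μ = 0)
    {p : ℝ} (hp : 1 ≤ p) (hi : Integrable (fun ω => |Y ω| ^ p) μ) :
    |∫ ω, f (Y ω) ∂μ| ≤ K ^ (1 - p) * ∫ ω, |Y ω| ^ p ∂μ := by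
  have hfi : Integrable (fun ω => f (Y ω)) μ :=
    Integrable.of_bound (hf.measurable.comp hY).aestronglyMeasurable K
      (ae_of_all _ fun ω => hf.abs_le _)
  have h : ∫ ω, f (Y ω) ∂μ = ∫ ω, (f (Y ω) - Y ω) ∂μ := by
    rw [integral_sub hfi hYi, hY0, sub_zero]
  rw [h, ← integral_const_mul]
  refine abs_integral_le_integral_abs.trans ?_
  exact integral_mono (hfi.sub hYi).abs (hi.const_mul _) fun ω => hf.abs_sub_le hK hp _

end Truncation

/-! ### Moment bounds for the truncated matrices and their consequences. -/

section TruncatedMatrices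

open scoped Matrix.Norms.L2Operator

theorem exists_integral_norm_truncated_pow_le {Ω : Type*} [MeasurableSpace Ω] {μ : Measure Ω}
    [IsProbabilityMeasure μ] {m : ℕ} {X : ℕ → ℕ → Ω → ℝ} {α β σ : ℝ} (hα : 2 ≤ α) (hβ : 0 < β)
    (hσ : 1 / 2 < σ) (hσβ : β ≤ σ) (hσα : 1 + β * (1 - α) < σ)
    (hX : ∀ i j, Measurable (X i j)) (hst : IsStationaryField X μ)
    (hm : IsMDependentOn m {p : ℕ × ℕ | p.1 ≤ p.2} (symmField X) μ)
    (ht : HasRegVaryingTail (X 0 0) α μ) (h0 : ∫ ω, X 0 0 ω ∂μ = 0) :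
    ∃ D : ℝ, 0 < D ∧ ∀ n : ℕ, 1 ≤ n → ∀ f : ℝ → ℝ, IsTruncation f ((n : ℝ) ^ β) →
      ∀ s : ℕ, s ≠ 0 → ∫ ω, ‖symmMatrix f X n ω‖ ^ (2 * s) ∂μ ≤
        D * n ^ 2 * (D * s * (n : ℝ) ^ σ) ^ (2 * s) := by
  -- The second moment may be infinite when α = 2, so a moment of order q slightly below 2 replaces
  -- it; the slack σ > 1/2 pays for the loss.
  obtain ⟨q, hq1, hq2, hq3⟩ : ∃ q : ℝ, 1 ≤ q ∧ q < 2 ∧ 1 + β * (2 - q) ≤ 2 * σ := by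
    refine ⟨max 1 (2 - (2 * σ - 1) / β), le_max_left _ _, ?_, ?_⟩
    · have : 0 < (2 * σ - 1) / β := div_pos (by linarith) hβ
      exact max_lt (by norm_num) (by linarith)
    · have h1 : 2 - max 1 (2 - (2 * σ - 1) / β) ≤ (2 * σ - 1) / β := by
        linarith [le_max_right 1 (2 - (2 * σ - 1) / β)]
      rw [le_div_iff₀ hβ] at h1
      linarith
  -- The order p < α is taken large enough that the mean matrix, of norm at most a constant times
  -- n^(1 + β(1 - p)), stays below the scale n^σ.
  obtain ⟨p, hp1, hp2, hp3⟩ : ∃ p : ℝ, 1 ≤ p ∧ p < α ∧ 1 + β * (1 - p) ≤ σ := by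
    refine ⟨max 1 (1 + (1 - σ) / β), le_max_left _ _, ?_, ?_⟩
    · have : (1 - σ) / β < α - 1 := by rw [div_lt_iff₀ hβ]; linarith
      exact max_lt (by linarith) (by linarith)
    · have h1 : (1 - σ) / β ≤ max 1 (1 + (1 - σ) / β) - 1 := by
        linarith [le_max_right 1 (1 + (1 - σ) / β)]
      rw [div_le_iff₀ hβ] at h1
      linarith
  have hiq := ht.integrable_rpow (hX 0 0) (q := q) (by linarith) (by linarith)
  have hip := ht.integrable_rpow (hX 0 0) (q := p) (by linarith) hp2
  have hi1 : Integrable (X 0 0) μ := by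
    have := ht.integrable_rpow (hX 0 0) (q := 1) one_pos (by linarith)
    simp only [Real.rpow_one] at this
    exact (integrable_norm_iff (hX 0 0).aestronglyMeasurable).1 this
  set Mq := ∫ ω, |X 0 0 ω| ^ q ∂μ with hMq
  set Mp := ∫ ω, |X 0 0 ω| ^ p ∂μ with hMp
  have hMq0 : 0 ≤ Mq := integral_nonneg fun ω => by positivity
  have hMp0 : 0 ≤ Mp := integral_nonneg fun ω => by positivity
  -- R dominates the mean constant Mp, and R² dominates the variance constant 16 (1 + Mq).
  set R := Mp + 4 * (1 + Mq) with hR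
  have hR0 : 0 < R := by positivity
  set N : ℝ := (m + 1) ^ 2 with hN
  have hN0 : 0 < N := by positivity
  refine ⟨N * (1 + Real.exp 4) + 2 * N * R, by positivity, ?_⟩
  intro n hn f hf s hs
  have hn0 : (0 : ℝ) < n := by exact_mod_cast hn
  have hn1 : (1 : ℝ) ≤ n := by exact_mod_cast hn
  have hs1 : (1 : ℝ) ≤ s := by exact_mod_cast Nat.one_le_iff_ne_zero.2 hs
  have hnβ : (0 : ℝ) < (n : ℝ) ^ β := by positivity
  set x := (n : ℝ) ^ σ with hx
  have hx0 : 0 < x := by positivity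
  have hxsq : (n : ℝ) ^ (2 * σ) = x ^ 2 := by
    rw [mul_comm, Real.rpow_mul hn0.le, Real.rpow_two]
  have hv : n * ∫ ω, f (X 0 0 ω) ^ 2 ∂μ ≤ (1 + Mq) * x ^ 2 := by
    calc n * ∫ ω, f (X 0 0 ω) ^ 2 ∂μ ≤ n * (((n : ℝ) ^ β) ^ (2 - q) * Mq) := by
          gcongr
          exact hf.integral_sq_le hq2.le hiq
      _ = (n : ℝ) ^ (1 + β * (2 - q)) * Mq := by
          rw [Real.rpow_add hn0, Real.rpow_one, Real.rpow_mul hn0.le, mul_assoc]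
      _ ≤ (n : ℝ) ^ (2 * σ) * (1 + Mq) := by
          gcongr
          linarith
      _ = _ := by rw [hxsq, mul_comm]
  have hKΛ : ((n : ℝ) ^ β) ^ 2 ≤ (1 + Mq) * x ^ 2 := by
    have h1 : (n : ℝ) ^ β ≤ x := Real.rpow_le_rpow_of_exponent_le hn1 hσβ
    calc ((n : ℝ) ^ β) ^ 2 ≤ x ^ 2 := by gcongr
      _ ≤ _ := le_mul_of_one_le_left (by positivity) (by linarith)
  have hb := hf.abs_integral_le hnβ (hX 0 0) hi1 h0 hp1 hip
  have hnb : (n : ℝ) * (((n : ℝ) ^ β) ^ (1 - p) * Mp) ≤ R * s * x := by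
    calc (n : ℝ) * (((n : ℝ) ^ β) ^ (1 - p) * Mp) = (n : ℝ) ^ (1 + β * (1 - p)) * Mp := by
          rw [Real.rpow_add hn0, Real.rpow_one, Real.rpow_mul hn0.le, mul_assoc]
      _ ≤ x * (R * s) := by
          have : Mp ≤ R * s := by
            calc Mp ≤ R := by linarith
              _ ≤ R * s := le_mul_of_one_le_right hR0.le hs1
          gcongr
          exact Real.rpow_le_rpow_of_exponent_le hn1 hp3
      _ = _ := mul_comm _ _
  have h16 : 16 * (s : ℝ) ^ 2 * ((1 + Mq) * x ^ 2) ≤ (R * s * x) ^ 2 := by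
    have h1 : 16 * (1 + Mq) ≤ R ^ 2 := by nlinarith
    calc 16 * (s : ℝ) ^ 2 * ((1 + Mq) * x ^ 2) = (16 * (1 + Mq)) * (s * x) ^ 2 := by ring
      _ ≤ R ^ 2 * (s * x) ^ 2 := by gcongr
      _ = _ := by ring
  have hmain := integral_norm_symmMatrix_pow_le (n := n) hX hst hm hf.measurable hf.abs_le
    (Λ := (1 + Mq) * x ^ 2) (by positivity) hKΛ hv hb hs
  refine hmain.trans ?_
  have hn2 : (1 : ℝ) ≤ (n : ℝ) ^ 2 := one_le_pow₀ hn1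
  calc (m + 1 : ℝ) ^ 2 * (2 * (m + 1) ^ 2) ^ (2 * s) *
        ((n * (((n : ℝ) ^ β) ^ (1 - p) * Mp)) ^ (2 * s) +
          Real.exp 4 * n ^ 2 * (16 * s ^ 2 * ((1 + Mq) * x ^ 2)) ^ s)
      ≤ N * (2 * N) ^ (2 * s) * (n ^ 2 * (R * s * x) ^ (2 * s) +
          Real.exp 4 * n ^ 2 * ((R * s * x) ^ 2) ^ s) := by
        have h3 : (n * (((n : ℝ) ^ β) ^ (1 - p) * Mp)) ^ (2 * s) ≤
            n ^ 2 * (R * s * x) ^ (2 * s) :=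
          (pow_le_pow_left₀ (by positivity) hnb _).trans
            (le_mul_of_one_le_left (by positivity) hn2)
        gcongr
    _ = (N * (1 + Real.exp 4)) * n ^ 2 * ((2 * N * R) * s * x) ^ (2 * s) := by
        rw [← pow_mul, show (2 * N * R) * s * x = (2 * N) * (R * s * x) by ring,
          mul_pow (2 * N)]
        ring
    _ ≤ _ := by
        have h4 : 0 ≤ N * (1 + Real.exp 4) := by positivity
        have h5 : 0 ≤ 2 * N * R := by positivity
        gcongr <;> linarith

variable {Ω : Type*}

theorem truncBelow_wignerMatrix_eq (X : ℕ → ℕ → Ω → ℝ) (a : ℕ → ℝ) (n : ℕ) (ω : Ω) {K : ℝ}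
    (ha : 0 < a (n ^ 2)) : truncBelow (wignerMatrix X a n ω) (K / a (n ^ 2)) =
      (a (n ^ 2))⁻¹ • symmMatrix (fun x => if |x| ≤ K then x else 0) X n ω := by
  ext i j
  simp only [truncBelow, truncAbove, wignerMatrix, symmMatrix, Matrix.sub_apply, Matrix.of_apply,
    Matrix.smul_apply, smul_eq_mul, abs_div, abs_of_pos ha, div_lt_div_iff_of_pos_right ha]
  rcases le_or_gt |symmField X i j ω| K with h | h
  · rw [if_neg (not_lt.2 h), if_pos h]; ring
  · rw [if_pos h, if_neg (not_le.2 h)]; ring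

variable [MeasurableSpace Ω]

theorem integrable_trace_smul_symmMatrix_pow {μ : Measure Ω} [IsProbabilityMeasure μ]
    {X : ℕ → ℕ → Ω → ℝ} (hX : ∀ i j, Measurable (X i j)) {f : ℝ → ℝ} {K : ℝ}
    (hf : IsTruncation f K) (n : ℕ) (c : ℝ) {s : ℕ} (hs : s ≠ 0) :
    Integrable (fun ω => Matrix.trace ((c • symmMatrix f X n ω) ^ (2 * s))) μ ∧
      ∫ ω, Matrix.trace ((c • symmMatrix f X n ω) ^ (2 * s)) ∂μ ≤
        n * |c| ^ (2 * s) * ∫ ω, ‖symmMatrix f X n ω‖ ^ (2 * s) ∂μ := by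
  have hK : 0 ≤ K := (abs_nonneg _).trans (hf.abs_le 0)
  have hsymm : ∀ ω, (c • symmMatrix f X n ω).IsSymm := fun ω => by
    rw [Matrix.IsSymm, Matrix.transpose_smul, (symmMatrix_isSymm f X n ω).eq]
  have h0 : ∀ ω, 0 ≤ Matrix.trace ((c • symmMatrix f X n ω) ^ (2 * s)) := fun ω =>
    le_trans (by positivity) ((hsymm ω).norm_pow_le_trace hs)
  have h1 : ∀ ω, Matrix.trace ((c • symmMatrix f X n ω) ^ (2 * s)) ≤
      n * |c| ^ (2 * s) * ‖symmMatrix f X n ω‖ ^ (2 * s) := fun ω => by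
    refine ((hsymm ω).trace_pow_le_norm s).trans_eq ?_
    rw [norm_smul, Real.norm_eq_abs, mul_pow, Fintype.card_fin, mul_assoc]
  have hi : Integrable (fun ω => ‖symmMatrix f X n ω‖ ^ (2 * s)) μ := by
    refine Integrable.of_bound (measurable_comp_symmMatrix hf.measurable hX
      (G := fun A => ‖A‖ ^ (2 * s)) (by fun_prop)).aestronglyMeasurable ((n * K) ^ (2 * s)) ?_
    refine ae_of_all _ fun ω => ?_
    rw [norm_pow, norm_norm]
    exact pow_le_pow_left₀ (norm_nonneg _) (norm_symmMatrix_le hK hf.abs_le X n ω) _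
  have hm : AEStronglyMeasurable
      (fun ω => Matrix.trace ((c • symmMatrix f X n ω) ^ (2 * s))) μ :=
    (measurable_comp_symmMatrix hf.measurable hX
      (G := fun A => Matrix.trace ((c • A) ^ (2 * s))) (by fun_prop)).aestronglyMeasurable
  refine ⟨(hi.const_mul (n * |c| ^ (2 * s))).mono' hm (ae_of_all _ fun ω => ?_), ?_⟩
  · rw [Real.norm_of_nonneg (h0 ω)]; exact h1 ω
  · rw [← integral_const_mul]
    exact integral_mono_of_nonneg (ae_of_all _ h0) (hi.const_mul _) (ae_of_all _ h1)

/-- Polynomially small factors raised to a slowly growing power beat every polynomial. -/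
theorem eventually_pow_le_exp {s : ℕ → ℕ} (hs : IsSlowlyVaryingSeq s) {C : ℝ} (hC : 0 < C)
    (hsC : ∀ᶠ n : ℕ in atTop, C * Real.log n < s n) {D σ τ : ℝ} (hD : 0 < D) (hστ : σ < τ) :
    ∀ᶠ n : ℕ in atTop, D * n ^ 3 * (((n : ℝ) ^ τ)⁻¹ * (D * s n * (n : ℝ) ^ σ)) ^ (2 * s n) ≤
      Real.exp (-s n) := by
  -- Half of the gap absorbs D s_n; the other half supplies the decay n^(-2δ s_n).
  set δ := (τ - σ) / 2 with hδ
  have hδ0 : 0 < δ := by rw [hδ]; linarith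
  have hlog : Tendsto (fun n : ℕ => Real.log n) atTop atTop :=
    Real.tendsto_log_atTop.comp tendsto_natCast_atTop_atTop
  filter_upwards [hsC, hs.eventually_const_mul_le_rpow hδ0 hD.le,
    -- In units of s_n, the rate 3/C pays for n³, one unit pays for D, and one unit remains as the
    -- final decay.
    (hlog.const_mul_atTop (mul_pos two_pos hδ0)).eventually_ge_atTop (3 / C + 2),
    (hlog.const_mul_atTop hC).eventually_ge_atTop D, eventually_ge_atTop 1] with n h1 h2 h3 h4 h5
  have hn0 : (0 : ℝ) < n := by exact_mod_cast h5
  have hs0 : (0 : ℝ) ≤ s n := Nat.cast_nonneg _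
  have hD1 : D ≤ Real.exp (s n) := by
    linarith [Real.add_one_le_exp (s n : ℝ)]
  have hn3 : (n : ℝ) ^ 3 ≤ Real.exp (3 / C * s n) := by
    rw [← Real.exp_log hn0, ← Real.exp_nat_mul, Real.exp_le_exp]
    have : Real.log n ≤ s n / C := by rw [le_div_iff₀ hC]; linarith
    calc ((3 : ℕ) : ℝ) * Real.log n ≤ 3 * (s n / C) := by push_cast; gcongr
      _ = _ := by ring
  have hpow : (((n : ℝ) ^ τ)⁻¹ * (D * s n * (n : ℝ) ^ σ)) ^ (2 * s n) ≤
      Real.exp (-((3 / C + 2) * s n)) := by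
    calc (((n : ℝ) ^ τ)⁻¹ * (D * s n * (n : ℝ) ^ σ)) ^ (2 * s n)
        ≤ (((n : ℝ) ^ τ)⁻¹ * ((n : ℝ) ^ δ * (n : ℝ) ^ σ)) ^ (2 * s n) := by gcongr
      _ = ((n : ℝ) ^ (-δ)) ^ (2 * s n) := by
          rw [← Real.rpow_neg hn0.le, ← Real.rpow_add hn0, ← Real.rpow_add hn0]
          congr 2
          rw [hδ]; ring
      _ = Real.exp (-(2 * δ * Real.log n * s n)) := by
          rw [Real.rpow_def_of_pos hn0, ← Real.exp_nat_mul]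
          congr 1
          push_cast
          ring
      _ ≤ _ := by
          rw [Real.exp_le_exp, neg_le_neg_iff]
          gcongr
  calc _ ≤ Real.exp (s n) * Real.exp (3 / C * s n) * Real.exp (-((3 / C + 2) * s n)) := by
        gcongr
    _ = _ := by
        rw [← Real.exp_add, ← Real.exp_add]
        congr 1
        ring

theorem tendstoInMeasure_spectralNorm2_truncBelow {μ : Measure Ω} [IsProbabilityMeasure μ]
    {X : ℕ → ℕ → Ω → ℝ} {α β σ D : ℝ} (hX : ∀ i j, Measurable (X i j)) (hα : 0 < α)
    (hσ0 : 0 < σ) (hσ : σ < 2 / α)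
    (ht : HasRegVaryingTail (X 0 0) α μ)
    (hD : ∀ n : ℕ, 1 ≤ n → ∀ f : ℝ → ℝ, IsTruncation f ((n : ℝ) ^ β) →
      ∀ s : ℕ, s ≠ 0 → ∫ ω, ‖symmMatrix f X n ω‖ ^ (2 * s) ∂μ ≤
        D * n ^ 2 * (D * s * (n : ℝ) ^ σ) ^ (2 * s)) {a : ℕ → ℝ}
    (ha : Tendsto (fun n : ℕ => (n : ℝ) * μ.real {ω | a n < |X 0 0 ω|}) atTop (𝓝 1)) :
    TendstoInMeasure μ (fun (n : ℕ) ω => spectralNorm2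
      (truncBelow (wignerMatrix X a n ω) ((n : ℝ) ^ β / a (n ^ 2)))) atTop (fun _ => 0) := by
  obtain ⟨τ, hτ1, hτ2⟩ := exists_between hσ
  have hb : ∀ᶠ n : ℕ in atTop, (n : ℝ) ^ τ ≤ a (n ^ 2) := by
    have h1 := ht.eventually_rpow_le hα (τ := τ / 2) (by linarith)
      (by rw [div_lt_iff₀ two_pos]; linarith [show 1 / α * 2 = 2 / α by ring]) ha
    filter_upwards [(tendsto_pow_atTop two_ne_zero).eventually h1] with n hn
    refine le_trans (le_of_eq ?_) hn
    rw [Nat.cast_pow, ← Real.rpow_natCast, ← Real.rpow_mul (Nat.cast_nonneg _)]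
    congr 1
    push_cast
    ring
  -- A fixed moment suffices: Markov's inequality leaves the power 2 - 2s(τ - σ) of n, which this s
  -- makes negative.
  obtain ⟨s, hs⟩ := exists_nat_gt (2 / (τ - σ))
  have hτσ : 0 < τ - σ := by linarith
  have hs0 : (0 : ℝ) < s := lt_trans (by positivity) hs
  have hsne : s ≠ 0 := by rintro rfl; simp at hs0
  rw [tendstoInMeasure_iff_measureReal_norm]
  intro ε hε
  set c := (ε ^ (2 * s))⁻¹ * D * (D * s) ^ (2 * s) with hc
  have hlim : Tendsto (fun n : ℕ => c * (n : ℝ) ^ (-(2 * s * (τ - σ) - 2))) atTop (𝓝 0) := by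
    have h2 : 0 < 2 * s * (τ - σ) - 2 := by
      rw [div_lt_iff₀ hτσ] at hs; nlinarith
    have := ((tendsto_rpow_neg_atTop h2).comp tendsto_natCast_atTop_atTop).const_mul c
    simpa using this
  refine squeeze_zero' (Eventually.of_forall fun _ => measureReal_nonneg) ?_ hlim
  filter_upwards [hb, eventually_ge_atTop 1] with n hn hn1
  have hn0 : (0 : ℝ) < n := by exact_mod_cast hn1
  have hnτ : 0 < (n : ℝ) ^ τ := by positivity
  have han : 0 < a (n ^ 2) := hnτ.trans_le hn
  set f : ℝ → ℝ := fun x => if |x| ≤ (n : ℝ) ^ β then x else 0 with hf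
  have hft : IsTruncation f ((n : ℝ) ^ β) := isTruncation_le (by positivity)
  have hi : Integrable (fun ω => ‖symmMatrix f X n ω‖ ^ (2 * s)) μ := by
    refine Integrable.of_bound (measurable_comp_symmMatrix hft.measurable hX
      (G := fun A => ‖A‖ ^ (2 * s)) (by fun_prop)).aestronglyMeasurable
        ((n * (n : ℝ) ^ β) ^ (2 * s)) ?_
    refine ae_of_all _ fun ω => ?_
    rw [norm_pow, norm_norm]
    exact pow_le_pow_left₀ (norm_nonneg _)
      (norm_symmMatrix_le (by positivity) hft.abs_le X n ω) _
  have hsub : {ω | ε ≤ ‖spectralNorm2 (truncBelow (wignerMatrix X a n ω)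
      ((n : ℝ) ^ β / a (n ^ 2))) - 0‖} ⊆
      {ω | (ε * (n : ℝ) ^ τ) ^ (2 * s) ≤ ‖symmMatrix f X n ω‖ ^ (2 * s)} := by
    intro ω hω
    have h1 : ε ≤ ‖truncBelow (wignerMatrix X a n ω) ((n : ℝ) ^ β / a (n ^ 2))‖ := by
      have h2 : ε ≤ ‖spectralNorm2 (truncBelow (wignerMatrix X a n ω)
        ((n : ℝ) ^ β / a (n ^ 2))) - 0‖ := hω
      rw [sub_zero] at h2
      exact h2.trans_eq (norm_norm (truncBelow (wignerMatrix X a n ω)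
        ((n : ℝ) ^ β / a (n ^ 2))))
    rw [truncBelow_wignerMatrix_eq X a n ω han, norm_smul, norm_inv, Real.norm_of_nonneg han.le,
      ← div_eq_inv_mul, le_div_iff₀ han] at h1
    exact pow_le_pow_left₀ (by positivity) ((by gcongr : _ ≤ ε * a (n ^ 2)).trans h1) _
  have hmk := mul_meas_ge_le_integral_of_nonneg (ae_of_all _ fun ω => by positivity) hi
    ((ε * (n : ℝ) ^ τ) ^ (2 * s))
  have hpos : 0 < (ε * (n : ℝ) ^ τ) ^ (2 * s) := by positivity
  calc _ ≤ μ.real {ω | (ε * (n : ℝ) ^ τ) ^ (2 * s) ≤ ‖symmMatrix f X n ω‖ ^ (2 * s)} :=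
        measureReal_mono hsub
    _ ≤ ((ε * (n : ℝ) ^ τ) ^ (2 * s))⁻¹ * (D * n ^ 2 * (D * s * (n : ℝ) ^ σ) ^ (2 * s)) := by
        rw [← div_eq_inv_mul, le_div_iff₀ hpos, mul_comm]
        exact hmk.trans (hD n hn1 f hft s hsne)
    _ = c * (n ^ 2 * (((n : ℝ) ^ τ) ^ (2 * s))⁻¹ * ((n : ℝ) ^ σ) ^ (2 * s)) := by
        rw [hc, mul_pow, mul_pow (D * s), mul_inv]; ring
    _ = _ := by
        congr 1
        rw [← Real.rpow_natCast, ← Real.rpow_natCast, ← Real.rpow_natCast, ← Real.rpow_mul hn0.le,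
          ← Real.rpow_mul hn0.le, ← Real.rpow_neg hn0.le, ← Real.rpow_add hn0, ← Real.rpow_add hn0]
        congr 1
        push_cast
        ring

end TruncatedMatrices

/-! ### The theorem. -/

theorem mainTheorem3 (C : ℝ) (hC : 0 < C) :
    ∃ γ₀ η : ℝ, 0 < γ₀ ∧ 0 < η ∧
      ∀ (Ω : Type*) [MeasurableSpace Ω] (μ : Measure Ω) [IsProbabilityMeasure μ]
        (m : ℕ) (α β : ℝ) (X : ℕ → ℕ → Ω → ℝ),
        2 ≤ α → α < 4 →
        4 / (3 * α) < β → β < 2 * (8 - α) / (α * (10 - α)) →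
        (∀ i j, Measurable (X i j)) →
        IsStationaryField X μ →
        IsMDependentOn m {p : ℕ × ℕ | p.1 ≤ p.2} (symmField X) μ →
        HasRegVaryingTail (X 0 0) α μ →
        ∫ ω, X 0 0 ω ∂μ = 0 →
        (∀ (ε : ℝ) (s : ℕ → ℕ),
          ε < min (min (2 / α - 1 / 2) (2 / α - β))
            ((1 / 4) * (8 / α - 1 - β * (5 - α / 2))) →
          IsSlowlyVaryingSeq s →
          (∀ᶠ n : ℕ in atTop, C * Real.log n < s n) →
          ∀ γ : ℝ, γ₀ < γ → ∀ᶠ n : ℕ in atTop,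
            Integrable (fun ω => Matrix.trace
              ((((n : ℝ) ^ (2 / α - ε))⁻¹ • smallMatrix X β n ω) ^ (2 * s n))) μ ∧
            (∫ ω, Matrix.trace
              ((((n : ℝ) ^ (2 / α - ε))⁻¹ • smallMatrix X β n ω) ^ (2 * s n)) ∂μ) /
              (((m : ℝ) + 1) * (8 + γ) * √(2 * Real.exp 1)) ^ (2 * s n)
              ≤ Real.exp (-η * s n)) ∧
        (∀ a : ℕ → ℝ,
          Tendsto (fun n : ℕ => (n : ℝ) * μ.real {ω | a n < |X 0 0 ω|}) atTop (𝓝 1) →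
          TendstoInMeasure μ
            (fun (n : ℕ) ω => spectralNorm2
              (truncBelow (wignerMatrix X a n ω) ((n : ℝ) ^ β / a (n ^ 2))))
            atTop (fun _ => 0)) := by
  -- The numerator alone is eventually at most exp(-s_n) and the denominator is at least 1, so C
  -- affects only how large n must be.
  refine ⟨1, 1, one_pos, one_pos, ?_⟩
  intro Ω _ μ _ m α β X hα2 hα4 hβ1 hβ2 hX hst hm ht h0
  have hα0 : 0 < α := by linarith
  have hβ0 : 0 < β := lt_trans (by positivity) hβ1
  -- From β > 4/(3α) and α ≥ 2 one gets β(α - 1) > 2/3, so the mean condition follows from σ > 1/2.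
  have hmean : 1 + β * (1 - α) < 1 / 2 := by
    rw [div_lt_iff₀ (by positivity)] at hβ1
    nlinarith
  constructor
  · intro ε s hε hs hsC γ hγ
    have hε1 := hε.trans_le ((min_le_left _ _).trans (min_le_left _ _))
    have hε2 := hε.trans_le ((min_le_left _ _).trans (min_le_right _ _))
    obtain ⟨σ, hσ1, hσ2⟩ := exists_between (show max (1 / 2) β < 2 / α - ε from
      max_lt (by linarith) (by linarith))
    have hσh := (le_max_left _ _).trans_lt hσ1
    obtain ⟨D, hD0, hD⟩ := exists_integral_norm_truncated_pow_le hα2 hβ0 hσh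
      ((le_max_right _ _).trans hσ1.le) (by linarith) hX hst hm ht h0
    filter_upwards [eventually_pow_le_exp hs hC hsC hD0 hσ2, hsC, eventually_ge_atTop 1]
      with n hn hsn hn1
    have hsn0 : s n ≠ 0 := by
      intro h
      rw [h, Nat.cast_zero] at hsn
      have : 0 ≤ Real.log n := Real.log_natCast_nonneg n
      nlinarith
    have hn0 : (0 : ℝ) < n := by exact_mod_cast hn1
    have htr := isTruncation_lt (K := (n : ℝ) ^ β) (by positivity)
    obtain ⟨hint, hle⟩ := integrable_trace_smul_symmMatrix_pow (μ := μ) hX htr n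
      (((n : ℝ) ^ (2 / α - ε))⁻¹) hsn0
    refine ⟨hint, ?_⟩
    have hden : 1 ≤ (((m : ℝ) + 1) * (8 + γ) * √(2 * Real.exp 1)) ^ (2 * s n) := by
      refine one_le_pow₀ (one_le_mul_of_one_le_of_one_le (one_le_mul_of_one_le_of_one_le ?_ ?_) ?_)
      · linarith [(Nat.cast_nonneg m : (0 : ℝ) ≤ m)]
      · linarith
      · rw [Real.one_le_sqrt]
        linarith [Real.add_one_le_exp (1 : ℝ)]
    have hpos : 0 < ((n : ℝ) ^ (2 / α - ε))⁻¹ := by positivity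
    rw [div_le_iff₀ (by linarith)]
    calc _ ≤ n * |((n : ℝ) ^ (2 / α - ε))⁻¹| ^ (2 * s n) *
          (D * n ^ 2 * (D * s n * (n : ℝ) ^ σ) ^ (2 * s n)) :=
          hle.trans (by gcongr; exact hD n hn1 _ htr _ hsn0)
      _ = D * n ^ 3 * (((n : ℝ) ^ (2 / α - ε))⁻¹ * (D * s n * (n : ℝ) ^ σ)) ^ (2 * s n) := by
          rw [abs_of_pos hpos, mul_pow]; ring
      _ ≤ Real.exp (-s n) := hn
      _ = Real.exp (-1 * s n) := by rw [neg_one_mul]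
      _ ≤ _ := le_mul_of_one_le_right (Real.exp_pos _).le hden
  · intro a ha
    -- The upper bound on β is 2/α times (8 - α)/(10 - α), a factor below 1.
    have hβα : β < 2 / α := by
      refine hβ2.trans ?_
      rw [div_lt_div_iff₀ (by nlinarith) hα0]
      nlinarith
    obtain ⟨σ, hσ1, hσ2⟩ := exists_between (show max (1 / 2) β < 2 / α from
      max_lt (by rw [div_lt_div_iff₀ two_pos hα0]; linarith) hβα)
    have hσh := (le_max_left _ _).trans_lt hσ1
    obtain ⟨D, -, hD⟩ := exists_integral_norm_truncated_pow_le hα2 hβ0 hσh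
      ((le_max_right _ _).trans hσ1.le) (by linarith) hX hst hm ht h0
    exact tendstoInMeasure_spectralNorm2_truncBelow hX hα0 (by linarith) hσ2 ht hD ha
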